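/- **Theorem 2.3.** Let $0<\theta<1$ and let $[a,b]\subset(-1,\infty)$. For $q\in[a,b]$ let $X_1,X_2,\ldots$ be i.i.d. words under $\mathbf P_q$ with $\mathbf P_q(X_1=i)=c\,(i+q)^{-1/\theta}$, $i\ge1$, where $c^{-1}=\sum_{i\ge1}(i+q)^{-1/\theta}$. Let $R_k$ be the number of different words among $X_1,\ldots,X_k$, with $R_0=0$. Let $A:[0,1]\to\mathbb R$ be the sum of a step function and a piecewise continuously differentiable function, with $A(t)=0$ on $[0,\delta]$ for some $\delta\in(0,1)$, $A(1)=0$ and $\int_0^1\log t\,dA(t)=1$. Put $$\widehat\theta=\widehat\theta_n=\int_0^1\log^+R_{[nt]}\,dA(t).$$ If $0<\widehat\theta<1$, then for $x>-1$ and $k\ge 0$ put $$r_{n,x}(k)=\sum_{i\ge1}\bigl(1-(1-\widehat p_i)^k\bigr),\qquad \widehat p_i=\frac{(i+x)^{-1/\widehat\theta}}{\sum_{j\ge1}(j+x)^{-1/\widehat\theta}}.$$ Call $x>-1$ a *shift estimate* at $n$ if $0<\widehat\theta_n<1$ and $r_{n,x}(n)=R_n$. Let $\widehat Z_n$ and,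 for a shift estimate $\widehat q_n$ at $n$, $\widetilde Z_n$ be the piecewise linear functions on $[0,1]$ with nodes $k/n$, $0\le k\le n$, and $$\widehat Z_n(k/n)=\frac{R_k-(k/n)^{\widehat\theta}R_n}{\sqrt{R_n}},\qquad \widetilde Z_n(k/n)=\frac{R_k-r_{n,\widehat q_n}(k)}{\sqrt{R_n}}.$$ Then: 1. for every $q\in[a,b]$, $\mathbf P_q$-almost surely a shift estimate exists for all sufficiently large $n$; 2. for every $q\in[a,b]$, $\mathbf P_q$-almost surely, for every choice of shift estimates $\widehat q_n$ (for all large $n$), $\sup_{0\le t\le1}|\widehat Z_n(t)-\widetilde Z_n(t)|\to0$ as $n\to\infty$; 3. the almost sure statements are uniform in $q\in[a,b]$: for every $\varepsilon>0$, $$\lim_{N\to\infty}\ \sup_{q\in[a,b]}\mathbf P_q\Bigl(\exists\,n\ge N:\ \text{there is no shift estimate at } n,\ \text{or } \sup_{0\le t\le1}|\widehat Z_n(t)-\widetilde Z_n(t)|>\varepsilon \text{ for some shift estimate } \widehat q_n\Bigr)=0 .$$ -/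

import Mathlib

open Filter Topology MeasureTheory ProbabilityTheory

noncomputable section

namespace TextBridge

/-- The Hurwitz zeta series `∑_{i ≥ 0} (i + x)^{-α}`. -/
def hurwitzSeries (α x : ℝ) : ℝ := ∑' i : ℕ, ((i : ℝ) + x) ^ (-α)

/-- The Zipf-Mandelbrot probability `c (i + q)^{-1/θ}` of the word with number `i ≥ 1`,
where `c = 1 / ∑_{i ≥ 1} (i + q)^{-1/θ}` is the normalizing constant. -/
def zmProb (θ q : ℝ) (i : ℕ) : ℝ :=
  (hurwitzSeries (1 / θ) (q + 1))⁻¹ * ((i : ℝ) + q) ^ (-(1 / θ))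

/-- The words `X 0, X 1, …` of a text are i.i.d. under the probability measure `P`, with the
Zipf-Mandelbrot distribution on the word numbers `1, 2, …`. -/
structure IsZMText {Ω : Type*} [MeasurableSpace Ω] (P : Measure Ω) (X : ℕ → Ω → ℕ)
    (θ q : ℝ) : Prop where
  prob : IsProbabilityMeasure P
  meas : ∀ j, Measurable (X j)
  indep : iIndepFun X P
  law : ∀ j i, 1 ≤ i → P {ω | X j ω = i} = ENNReal.ofReal (zmProb θ q i)

/-- `R_k`: the number of different words among the first `k` words of the text `w`. -/
def numDistinct (w : ℕ → ℕ) (k : ℕ) : ℕ := ((Finset.range k).image w).card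

/-- A step function on `[0,1]`: constant between consecutive points of a finite set. -/
def IsStepFun (S : ℝ → ℝ) : Prop :=
  ∃ F : Finset ℝ, ∀ x y, 0 ≤ x → x ≤ y → y ≤ 1 → (∀ z ∈ F, z ∉ Set.Icc x y) → S x = S y

/-- A continuous, piecewise continuously differentiable function on `[0,1]` (`C¹` up to the end
points on each interval of a finite partition). -/
def IsPiecewiseC1 (B : ℝ → ℝ) : Prop :=
  ContinuousOn B (Set.Icc 0 1) ∧
    ∃ F : Finset ℝ, ∀ x y, 0 ≤ x → x < y → y ≤ 1 → (∀ z ∈ F, z ∉ Set.Ioo x y) →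
      ContDiffOn ℝ 1 B (Set.Icc x y)

/-- The Lebesgue-Stieltjes integral `∫₀¹ f dA` for a function `A` that vanishes outside `(0,1)`
and is the sum of a step function and a piecewise `C¹` function on `[0,1]`: the atoms of `dA` are
the jumps `A(x+) - A(x-)`, and its absolutely continuous part has the density `A'`. -/
def stieltjesIntegral (f A : ℝ → ℝ) : ℝ :=
  (∑ᶠ x : ℝ, f x * (Function.rightLim A x - Function.leftLim A x)) +
    ∫ t in (0 : ℝ)..1, f t * deriv A t

/-- The admissible weight functions `A` on `[0,1]`, extended by zero to the real line. -/
structure IsWeight (A : ℝ → ℝ) : Prop where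
  zero_left : ∃ δ : ℝ, 0 < δ ∧ δ < 1 ∧ ∀ t ≤ δ, A t = 0
  zero_right : ∀ t, 1 ≤ t → A t = 0
  regular : ∃ S B : ℝ → ℝ, IsStepFun S ∧ IsPiecewiseC1 B ∧
    ∀ t ∈ Set.Icc (0 : ℝ) 1, A t = S t + B t
  integral_log : stieltjesIntegral Real.log A = 1

/-- The estimate `θ̂ = ∫₀¹ log⁺ R_{[nt]} dA(t)`. -/
def thetaHat (A : ℝ → ℝ) (w : ℕ → ℕ) (n : ℕ) : ℝ :=
  stieltjesIntegral (fun t => Real.posLog (numDistinct w ⌊(n : ℝ) * t⌋₊)) A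

/-- `∑_{i ≥ 1} (1 - (1 - p_i)^k)` for the Zipf-Mandelbrot law with parameters `θ`, `q`. -/
def meanDistinct (θ q : ℝ) (k : ℕ) : ℝ :=
  ∑' i : ℕ, (1 - (1 - zmProb θ q (i + 1)) ^ k)

/-- `x` is a value of the shift estimate `q̂` for the first `n` words of the text `w`: the
parameters `θ̂`, `x` define a Zipf-Mandelbrot law, and `r(n) = R_n`. -/
def IsShiftEstimate (A : ℝ → ℝ) (w : ℕ → ℕ) (n : ℕ) (x : ℝ) : Prop :=
  0 < thetaHat A w n ∧ thetaHat A w n < 1 ∧ -1 < x ∧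
    meanDistinct (thetaHat A w n) x n = numDistinct w n

/-- The piecewise linear function of `t ∈ [0,1]` with the value `v k` at `t = k/n`. -/
def interpolate (v : ℕ → ℝ) (n : ℕ) (t : ℝ) : ℝ :=
  v ⌊(n : ℝ) * t⌋₊ + ((n : ℝ) * t - ⌊(n : ℝ) * t⌋₊) * (v (⌊(n : ℝ) * t⌋₊ + 1) - v ⌊(n : ℝ) * t⌋₊)

/-- The power-law bridge `Ẑ_n`. -/
def powerBridge (A : ℝ → ℝ) (w : ℕ → ℕ) (n : ℕ) : ℝ → ℝ :=
  interpolate (fun k => ((numDistinct w k : ℝ) -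
    ((k : ℝ) / n) ^ thetaHat A w n * numDistinct w n) / √(numDistinct w n : ℝ)) n

/-- The empirical text bridge `Z̃_n` for the value `x` of the shift estimate. -/
def textBridge (A : ℝ → ℝ) (w : ℕ → ℕ) (n : ℕ) (x : ℝ) : ℝ → ℝ :=
  interpolate (fun k => ((numDistinct w k : ℝ) -
    meanDistinct (thetaHat A w n) x k) / √(numDistinct w n : ℝ)) n

end TextBridge

end

noncomputable section

namespace TextBridge

/-! The mean number of distinct words is `growthCoeff θ x * k ^ θ` up to an error of at most `3 +
x`, for every `k` and every `θ` in `(0, 1)` (`abs_meanDistinct_sub_le`). If `x` is a shift estimate,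
the case `k = n` says that `R_n` itself is `D * n ^ θ̂` up to a constant. So both centerings, `(k /
n) ^ θ̂ * R_n` and `r_{n,x}(k)`, equal `D * k ^ θ̂ + O(1)`, and the bridges differ by a multiple of
`(3 + x) / √R_n`. This part is pure algebra; it remains to see that shift estimates exist and are
bounded above, and that `R_n → ∞`.

Occurrences of different words are negatively correlated, so the variance of `R_k` is at most its
mean. Chebyshev's inequality along `k = m ^ L` with `L * θ ≥ 4` gives deviation probabilities of
order `m⁻²`, and monotonicity of `R` fills the gaps: `log R_k = log D + θ log k + O(k ^ (-1/L))`
with `D = growthCoeff θ q`. Since `dA` has total mass zero and integrates `log` to one, `θ̂ - θ =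
O(n ^ (-1/L))`, hence `n ^ (θ̂ - θ) → 1`.

The leading coefficient is strictly increasing in the shift and continuous in the exponent. Thus for
fixed `x₀ < a` and `x₁ > b` the value `R_n` eventually lies strictly between `r_{n,x₀}(n)` and
`r_{n,x₁}(n)`. The intermediate value theorem yields a shift estimate, and monotonicity of
`r_{n,x}(n)` in `x` (a one-crossing argument) puts every shift estimate below `x₁`.

All of this is deterministic off the deviation event, with constants free of `q` in `[a, b]`, and
the probability of that event is at most the tail of a fixed convergent series. This gives the
uniform statement, and the almost sure ones follow from it. -/

/-! ### The Hurwitz series and the Zipf-Mandelbrot law. -/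

lemma summable_hurwitz {α x : ℝ} (hα : 1 < α) (hx : 0 < x) :
    Summable fun i : ℕ => ((i : ℝ) + x) ^ (-α) := by
  refine ((Real.summable_one_div_nat_add_rpow x α).2 hα).congr fun i => ?_
  have : (0 : ℝ) < i + x := by positivity
  rw [abs_of_pos this, Real.rpow_neg this.le, one_div]

lemma hurwitzSeries_pos {α x : ℝ} (hα : 1 < α) (hx : 0 < x) : 0 < hurwitzSeries α x :=
  (summable_hurwitz hα hx).tsum_pos (fun i => by positivity) 0 (by simp; positivity)

lemma hurwitzSeries_strictAnti {α x y : ℝ} (hα : 1 < α) (hx : 0 < x) (hxy : x < y) :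
    hurwitzSeries α y < hurwitzSeries α x := by
  have h : ∀ i : ℕ, ((i : ℝ) + y) ^ (-α) < ((i : ℝ) + x) ^ (-α) := fun i =>
    Real.rpow_lt_rpow_of_neg (by positivity) (by linarith) (by linarith)
  exact Summable.tsum_lt_tsum (i := 0) (fun i => (h i).le) (h 0)
    (summable_hurwitz hα (hx.trans hxy)) (summable_hurwitz hα hx)

lemma hurwitzSeries_anti {α x y : ℝ} (hα : 1 < α) (hx : 0 < x) (hxy : x ≤ y) :
    hurwitzSeries α y ≤ hurwitzSeries α x := by
  rcases hxy.eq_or_lt with rfl | h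
  · exact le_rfl
  · exact (hurwitzSeries_strictAnti hα hx h).le

lemma continuousOn_hurwitzSeries_shift {α x₀ : ℝ} (hα : 1 < α) (hx : 0 < x₀) :
    ContinuousOn (fun x => hurwitzSeries α x) (Set.Ici x₀) := by
  refine continuousOn_tsum (u := fun i : ℕ => ((i : ℝ) + x₀) ^ (-α)) (fun i x hx' => ?_)
    (summable_hurwitz hα hx) (fun i x hx' => ?_)
  · have h0 : (0 : ℝ) < i + x := by
      have : 0 < x := hx.trans_le hx'
      positivity
    exact ContinuousAt.continuousWithinAt
      (ContinuousAt.rpow_const (by fun_prop) (Or.inl h0.ne'))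
  · have h1 : x₀ ≤ x := hx'
    have h2 : 0 < x := hx.trans_le h1
    have h0 : (0 : ℝ) < i + x := by positivity
    rw [Real.norm_of_nonneg (by positivity)]
    exact Real.rpow_le_rpow_of_nonpos (by positivity) (by linarith) (by linarith)

lemma continuousAt_hurwitzSeries_exponent {α x : ℝ} (hα : 1 < α) (hx : 0 < x) :
    ContinuousAt (fun β => hurwitzSeries β x) α := by
  obtain ⟨β, hβ1, hβ⟩ := exists_between hα
  suffices h : ContinuousOn (fun γ => hurwitzSeries γ x) (Set.Icc β (α + 1)) from
    h.continuousAt (Icc_mem_nhds hβ (by linarith))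
  -- The base `i + x` may lie on either side of 1, so the terms at both end exponents are added to
  -- dominate.
  refine continuousOn_tsum
    (u := fun i : ℕ => ((i : ℝ) + x) ^ (-β) + ((i : ℝ) + x) ^ (-(α + 1)))
    (fun i => ?_) ((summable_hurwitz hβ1 hx).add (summable_hurwitz (by linarith) hx))
    (fun i γ hγ => ?_)
  · have h0 : (0 : ℝ) < i + x := by positivity
    exact (Continuous.rpow continuous_const (by fun_prop) fun _ => Or.inl h0.ne').continuousOn
  · have h0 : (0 : ℝ) < i + x := by positivity
    rw [Real.norm_of_nonneg (by positivity)]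
    rcases le_total 1 ((i : ℝ) + x) with h | h
    · exact (Real.rpow_le_rpow_of_exponent_le h (neg_le_neg hγ.1)).trans
        (le_add_of_nonneg_right (by positivity))
    · exact (Real.rpow_le_rpow_of_exponent_ge h0 h (neg_le_neg hγ.2)).trans
        (le_add_of_nonneg_left (by positivity))

lemma zmProb_pos {θ q : ℝ} (h0 : 0 < θ) (h1 : θ < 1) (hq : -1 < q) (i : ℕ) :
    0 < zmProb θ q (i + 1) := by
  have := hurwitzSeries_pos (α := 1 / θ) (x := q + 1) (by rw [lt_div_iff₀ h0]; linarith)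
    (by linarith)
  have h2 : (0 : ℝ) < ((i + 1 : ℕ) : ℝ) + q := by push_cast; linarith [i.cast_nonneg (α := ℝ)]
  unfold zmProb
  positivity

lemma hasSum_zmProb {θ q : ℝ} (h0 : 0 < θ) (h1 : θ < 1) (hq : -1 < q) :
    HasSum (fun i : ℕ => zmProb θ q (i + 1)) 1 := by
  have hα : 1 < 1 / θ := by rw [lt_div_iff₀ h0]; linarith
  have hz := hurwitzSeries_pos hα (x := q + 1) (by linarith)
  have := (summable_hurwitz hα (x := q + 1) (by linarith)).hasSum.mul_left
    (hurwitzSeries (1 / θ) (q + 1))⁻¹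
  rw [show ∑' i : ℕ, ((i : ℝ) + (q + 1)) ^ (-(1 / θ)) = hurwitzSeries (1 / θ) (q + 1) from rfl,
    inv_mul_cancel₀ hz.ne'] at this
  have e (i : ℕ) : zmProb θ q (i + 1) =
      (hurwitzSeries (1 / θ) (q + 1))⁻¹ * ((i : ℝ) + (q + 1)) ^ (-(1 / θ)) := by
    rw [zmProb, Nat.cast_succ, add_assoc, add_comm 1 q]
  simpa only [e] using this

lemma zmProb_le_one {θ q : ℝ} (h0 : 0 < θ) (h1 : θ < 1) (hq : -1 < q) (i : ℕ) :
    zmProb θ q (i + 1) ≤ 1 :=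
  le_hasSum (hasSum_zmProb h0 h1 hq) i fun j _ => (zmProb_pos h0 h1 hq j).le

/-! ### Power-law asymptotics of the mean with a bounded error. -/

/-- The constant `∫₀^∞ (1 - exp (-z^{-1/θ})) dz = Γ(1 - θ)`. -/
def gapIntegral (θ : ℝ) : ℝ := ∫ z in Set.Ioi (0 : ℝ), (1 - Real.exp (-(z ^ (-(1 / θ)))))

/-- The leading coefficient of `meanDistinct θ x k ∼ growthCoeff θ x * k ^ θ`. -/
def growthCoeff (θ x : ℝ) : ℝ := gapIntegral θ * ((hurwitzSeries (1 / θ) (x + 1))⁻¹) ^ θ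

/-- Poissonization costs at most `p` per word whatever `k` is, hence at most 1 after summation over
a probability law. In the induction the error `p` shrinks by the factor `1 - p` and gains `p ^ 2`,
which again gives `p`. -/
lemma exp_neg_mul_sub_pow_bounds {p : ℝ} (h0 : 0 ≤ p) (h1 : p ≤ 1) (k : ℕ) :
    (1 - p) ^ k ≤ Real.exp (-(k * p)) ∧ Real.exp (-(k * p)) ≤ (1 - p) ^ k + p := by
  have e (k : ℕ) : Real.exp (-(k * p)) = Real.exp (-p) ^ k := by
    rw [← Real.exp_nat_mul]; ring_nf
  have l1 : 1 - p ≤ Real.exp (-p) := by linarith [Real.add_one_le_exp (-p)]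
  have l2 : Real.exp (-p) ≤ 1 - p + p ^ 2 := by
    have := Real.abs_exp_sub_one_sub_id_le (x := -p) (by rw [abs_neg, abs_of_nonneg h0]; exact h1)
    have := (abs_le.1 this).2
    nlinarith
  have l3 : Real.exp (-p) ≤ 1 := by simpa using h0
  simp only [e]
  refine ⟨pow_le_pow_left₀ (by linarith) l1 k, ?_⟩
  induction k with
  | zero => simpa using h0
  | succ k ih =>
    have l4 : Real.exp (-p) ^ k ≤ 1 := pow_le_one₀ (Real.exp_pos _).le l3
    have l5 : 0 ≤ Real.exp (-p) ^ k := by positivity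
    rw [pow_succ, pow_succ]
    nlinarith [mul_le_mul_of_nonneg_left l2 l5, mul_le_mul_of_nonneg_right ih (sub_nonneg.2 h1),
      mul_le_mul_of_nonneg_right l4 (sq_nonneg p)]

/-- An integrable function dominating `1 - exp (-z ^ (-γ))` for all `γ ≥ β`. -/
def gapMajorant (β z : ℝ) : ℝ :=
  (Set.Ioc (0 : ℝ) 1).indicator (fun _ => 1) z + (Set.Ioi (1 : ℝ)).indicator (fun z => z ^ (-β)) z

lemma integrable_gapMajorant {β : ℝ} (hβ : 1 < β) : Integrable (gapMajorant β) := by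
  refine Integrable.add ?_ ?_
  · rw [integrable_indicator_iff measurableSet_Ioc]
    exact integrableOn_const (by simp)
  · rw [integrable_indicator_iff measurableSet_Ioi]
    exact integrableOn_Ioi_rpow_of_lt (by linarith) one_pos

lemma gap_nonneg {s z γ : ℝ} (hs : 0 ≤ s) (hz : 0 < z) :
    0 ≤ 1 - Real.exp (-(s * z ^ (-γ))) := by
  have : 0 ≤ s * z ^ (-γ) := by positivity
  simpa using this

lemma gap_le_majorant {s z γ β : ℝ} (_hs : 0 ≤ s) (hz : 0 < z) (hγ : β ≤ γ) :
    1 - Real.exp (-(s * z ^ (-γ))) ≤ max 1 s * gapMajorant β z := by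
  unfold gapMajorant
  rcases le_or_gt z 1 with h | h
  · rw [Set.indicator_of_mem (by exact ⟨hz, h⟩), Set.indicator_of_notMem (by simpa using h)]
    linarith [Real.exp_pos (-(s * z ^ (-γ))), le_max_left 1 s]
  · rw [Set.indicator_of_notMem (by simp [h]), Set.indicator_of_mem (by exact h), zero_add]
    calc 1 - Real.exp (-(s * z ^ (-γ))) ≤ s * z ^ (-γ) := by
          linarith [Real.add_one_le_exp (-(s * z ^ (-γ)))]
      _ ≤ max 1 s * z ^ (-β) := by
          gcongr
          · exact le_max_right _ _
          · exact h.le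

lemma measurable_gap (s γ : ℝ) : Measurable fun z : ℝ => 1 - Real.exp (-(s * z ^ (-γ))) := by
  fun_prop

lemma integrableOn_gap {s γ : ℝ} (hs : 0 ≤ s) (hγ : 1 < γ) :
    IntegrableOn (fun z : ℝ => 1 - Real.exp (-(s * z ^ (-γ)))) (Set.Ioi 0) := by
  refine Integrable.mono' ((integrable_gapMajorant hγ).const_mul (max 1 s)).integrableOn
    (measurable_gap s γ).aestronglyMeasurable ?_
  refine (ae_restrict_iff' measurableSet_Ioi).2 (ae_of_all _ fun z hz => ?_)
  rw [Real.norm_of_nonneg (gap_nonneg hs hz)]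
  exact gap_le_majorant hs hz le_rfl

lemma one_lt_one_div_of_mem {θ : ℝ} (h0 : 0 < θ) (h1 : θ < 1) : 1 < 1 / θ := by
  rw [lt_div_iff₀ h0]; linarith

lemma integral_gap {s θ : ℝ} (hs : 0 ≤ s) (h0 : 0 < θ) :
    ∫ z in Set.Ioi (0 : ℝ), (1 - Real.exp (-(s * z ^ (-(1 / θ))))) = s ^ θ * gapIntegral θ := by
  rcases hs.eq_or_lt with rfl | hs
  · simp [Real.zero_rpow h0.ne']
  -- Scaling `z` by `s ^ θ` removes `s` from the exponential.
  have h := integral_comp_mul_left_Ioi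
    (fun z : ℝ => 1 - Real.exp (-(s * z ^ (-(1 / θ))))) 0 (b := s ^ θ) (by positivity)
  rw [mul_zero, smul_eq_mul] at h
  have e : ∫ z in Set.Ioi (0 : ℝ), (1 - Real.exp (-(s * (s ^ θ * z) ^ (-(1 / θ))))) =
      gapIntegral θ := by
    refine setIntegral_congr_fun measurableSet_Ioi fun z hz => ?_
    have hz : 0 < z := hz
    have : s * (s ^ θ * z) ^ (-(1 / θ)) = z ^ (-(1 / θ)) := by
      rw [Real.mul_rpow (by positivity) hz.le, ← Real.rpow_mul hs.le, mul_neg,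
        mul_one_div_cancel h0.ne', Real.rpow_neg_one, mul_inv_cancel_left₀ hs.ne']
    simp only [this]
  rw [← e, h, mul_inv_cancel_left₀ (by positivity)]

lemma gapIntegral_pos {θ : ℝ} (h0 : 0 < θ) (h1 : θ < 1) : 0 < gapIntegral θ := by
  have hi := integrableOn_gap (s := 1) zero_le_one (one_lt_one_div_of_mem h0 h1)
  simp only [one_mul] at hi
  unfold gapIntegral
  rw [setIntegral_pos_iff_support_of_nonneg_ae ?_ hi]
  · have : Set.Ioi (0 : ℝ) ⊆
        (Function.support fun z : ℝ => 1 - Real.exp (-(z ^ (-(1 / θ))))) := fun z hz => by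
      have hz : 0 < z := hz
      have : 0 < z ^ (-(1 / θ)) := by positivity
      have : Real.exp (-(z ^ (-(1 / θ)))) < 1 := by simpa using this
      exact (sub_pos.2 this).ne'
    rw [Set.inter_eq_right.2 this]
    simp
  · refine (ae_restrict_iff' measurableSet_Ioi).2 (ae_of_all _ fun z hz => ?_)
    simpa using gap_nonneg (γ := 1 / θ) zero_le_one hz

lemma continuousAt_gapIntegral {θ : ℝ} (h0 : 0 < θ) (h1 : θ < 1) :
    ContinuousAt gapIntegral θ := by
  obtain ⟨η, hη, hη1⟩ := exists_between h1
  have hη0 : 0 < η := h0.trans hη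
  refine continuousAt_of_dominated (bound := fun z => max 1 1 * gapMajorant (1 / η) z)
    (Eventually.of_forall fun t => ?_) ?_ ?_ ?_
  · simpa using (measurable_gap 1 (1 / t)).aestronglyMeasurable
  · filter_upwards [Ioo_mem_nhds h0 hη] with t ht
    refine (ae_restrict_iff' measurableSet_Ioi).2 (ae_of_all _ fun z hz => ?_)
    have := gap_nonneg (γ := 1 / t) zero_le_one hz
    have h2 := gap_le_majorant (s := 1) zero_le_one hz (one_div_le_one_div_of_le ht.1 ht.2.le)
    rw [one_mul] at this h2
    rw [Real.norm_of_nonneg this]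
    exact h2
  · exact ((integrable_gapMajorant (one_lt_one_div_of_mem hη0 hη1)).const_mul _).integrableOn
  · refine (ae_restrict_iff' measurableSet_Ioi).2 (ae_of_all _ fun z hz => ?_)
    have hz : z ≠ 0 := ne_of_gt hz
    have : ContinuousAt (fun t : ℝ => z ^ (-(1 / t))) θ :=
      ContinuousAt.rpow continuousAt_const
        (by simp only [one_div]; exact (continuousAt_inv₀ h0.ne').neg) (Or.inl hz)
    exact continuousAt_const.sub (Real.continuous_exp.continuousAt.comp this.neg)

/-- By monotonicity the sum lies between the integral over `(u, ∞)` and that integral plus the first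
term, which is at most 1. The integral over `(0, u]` is between 0 and `u`. -/
lemma abs_tsum_sub_integral_le {h : ℝ → ℝ} {u : ℝ} (hu : 0 < u)
    (anti : AntitoneOn h (Set.Ioi 0)) (h0 : ∀ z, 0 < z → 0 ≤ h z) (h1 : ∀ z, 0 < z → h z ≤ 1)
    (hi : IntegrableOn h (Set.Ioi 0)) (hs : Summable fun i : ℕ => h (i + u)) :
    |∑' i : ℕ, h (i + u) - ∫ z in Set.Ioi 0, h z| ≤ 1 + u := by
  have hiu : IntegrableOn h (Set.Ioi u) := hi.mono_set (Set.Ioi_subset_Ioi hu.le)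
  have anti' (N : ℕ) : AntitoneOn h (Set.Icc u (u + N)) :=
    anti.mono fun z hz => hu.trans_le hz.1
  have split : ∫ z in Set.Ioi 0, h z = (∫ z in Set.Ioc 0 u, h z) + ∫ z in Set.Ioi u, h z := by
    rw [← setIntegral_union Set.Ioc_disjoint_Ioi_same measurableSet_Ioi
      (hi.mono_set Set.Ioc_subset_Ioi_self) hiu, Set.Ioc_union_Ioi_eq_Ioi hu.le]
  have b0 : 0 ≤ ∫ z in Set.Ioc 0 u, h z :=
    setIntegral_nonneg measurableSet_Ioc fun z hz => h0 z hz.1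
  have b1 : ∫ z in Set.Ioc 0 u, h z ≤ u := by
    have := setIntegral_mono_on (s := Set.Ioc 0 u) (hi.mono_set Set.Ioc_subset_Ioi_self)
      (integrableOn_const (C := (1 : ℝ)) (by simp)) measurableSet_Ioc fun z hz => h1 z hz.1
    simpa [hu.le] using this
  have t0 : Tendsto (fun N : ℕ => u + (N : ℝ)) atTop atTop :=
    tendsto_atTop_add_const_left _ _ tendsto_natCast_atTop_atTop
  have t1 : Tendsto (fun N : ℕ => ∫ z in u..u + N, h z) atTop (𝓝 (∫ z in Set.Ioi u, h z)) :=
    intervalIntegral_tendsto_integral_Ioi u hiu t0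
  have t2 := hs.hasSum.tendsto_sum_nat
  have c1 : ∫ z in Set.Ioi u, h z ≤ ∑' i : ℕ, h (i + u) :=
    le_of_tendsto_of_tendsto' t1 t2 fun N => by
      simpa only [add_comm u] using (anti' N).integral_le_sum
  have c2 : ∑' i : ℕ, h (i + u) ≤ 1 + ∫ z in Set.Ioi u, h z := by
    refine le_of_tendsto_of_tendsto' ((tendsto_add_atTop_iff_nat 1).2 t2) (t1.const_add 1)
      fun N => ?_
    rw [Finset.sum_range_succ']
    have l1 := (anti' N).sum_le_integral
    have l2 : h ((0 : ℕ) + u) ≤ 1 := h1 _ (by simpa using hu)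
    have l3 : ∀ i : ℕ, u + ((i + 1 : ℕ) : ℝ) = ((i + 1 : ℕ) : ℝ) + u := fun i => add_comm _ _
    simp only [l3] at l1
    linarith
  rw [split, abs_le]
  constructor <;> linarith

lemma one_sub_pow_le_mul {p : ℝ} (h1 : p ≤ 1) (k : ℕ) :
    1 - (1 - p) ^ k ≤ k * p := by
  have := one_add_mul_le_pow (a := -p) (by linarith) k
  rw [← sub_eq_add_neg] at this
  linarith

lemma one_sub_pow_nonneg {p : ℝ} (h0 : 0 ≤ p) (h1 : p ≤ 1) (k : ℕ) : 0 ≤ 1 - (1 - p) ^ k :=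
  sub_nonneg.2 (pow_le_one₀ (by linarith) (by linarith))

lemma summable_meanDistinct {θ q : ℝ} (h0 : 0 < θ) (h1 : θ < 1) (hq : -1 < q) (k : ℕ) :
    Summable fun i : ℕ => 1 - (1 - zmProb θ q (i + 1)) ^ k :=
  Summable.of_nonneg_of_le
    (fun i => one_sub_pow_nonneg (zmProb_pos h0 h1 hq i).le (zmProb_le_one h0 h1 hq i) k)
    (fun i => one_sub_pow_le_mul (zmProb_le_one h0 h1 hq i) k)
    ((hasSum_zmProb h0 h1 hq).summable.mul_left _)

lemma growthCoeff_pos {θ x : ℝ} (h0 : 0 < θ) (h1 : θ < 1) (hx : -1 < x) : 0 < growthCoeff θ x := by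
  have := hurwitzSeries_pos (one_lt_one_div_of_mem h0 h1) (x := x + 1) (by linarith)
  have := gapIntegral_pos h0 h1
  unfold growthCoeff
  positivity

/-- The error is 1 from Poissonization plus `1 + u` from replacing the sum by an integral, where `u
= 1 + x` is the first sampling point. It is uniform in `k` and `θ`, so the estimate remains usable
with the random exponent `θ̂`. -/
lemma abs_meanDistinct_sub_le {θ x : ℝ} (h0 : 0 < θ) (h1 : θ < 1) (hx : -1 < x) (k : ℕ) :
    |meanDistinct θ x k - growthCoeff θ x * (k : ℝ) ^ θ| ≤ 3 + x := by
  have hα := one_lt_one_div_of_mem h0 h1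
  set c := (hurwitzSeries (1 / θ) (x + 1))⁻¹ with hc
  have hc0 : 0 < c := inv_pos.2 (hurwitzSeries_pos hα (by linarith))
  have ez (i : ℕ) : zmProb θ x (i + 1) = c * ((i : ℝ) + (1 + x)) ^ (-(1 / θ)) := by
    rw [zmProb, Nat.cast_succ, add_assoc]
  have hp0 (i : ℕ) := (zmProb_pos h0 h1 hx i).le
  have hp1 (i : ℕ) := zmProb_le_one h0 h1 hx i
  have hsp := hasSum_zmProb h0 h1 hx
  have hkc : 0 ≤ k * c := by positivity
  set h : ℝ → ℝ := fun z => 1 - Real.exp (-(k * c * z ^ (-(1 / θ)))) with hh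
  have ehi (i : ℕ) : h (i + (1 + x)) = 1 - Real.exp (-(k * zmProb θ x (i + 1))) := by
    simp only [hh, ez, mul_assoc]
  have b (i : ℕ) := exp_neg_mul_sub_pow_bounds (hp0 i) (hp1 i) k
  have hs1 := summable_meanDistinct h0 h1 hx k
  have hs2 : Summable fun i : ℕ => h (i + (1 + x)) := by
    refine hs1.of_nonneg_of_le (fun i => ?_) (fun i => ?_)
    · exact gap_nonneg hkc (by linarith [i.cast_nonneg (α := ℝ)])
    · rw [ehi]; linarith [(b i).1]
  have m1 : ∑' i : ℕ, h (i + (1 + x)) ≤ meanDistinct θ x k :=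
    hs2.tsum_le_tsum (fun i => by rw [ehi]; linarith [(b i).1]) hs1
  have m2 : meanDistinct θ x k ≤ (∑' i : ℕ, h (i + (1 + x))) + 1 := by
    refine le_of_le_of_eq ?_ (congrArg (_ + ·) hsp.tsum_eq)
    rw [← hs2.tsum_add hsp.summable]
    exact hs1.tsum_le_tsum (fun i => by rw [ehi]; linarith [(b i).2]) (hs2.add hsp.summable)
  have m3 := abs_tsum_sub_integral_le (h := h) (u := 1 + x) (by linarith) ?_
    (fun z hz => gap_nonneg hkc hz)
    (fun z hz => by simp only [hh]; linarith [Real.exp_pos (-(k * c * z ^ (-(1 / θ))))])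
    (integrableOn_gap hkc hα) hs2
  · rw [integral_gap hkc h0, Real.mul_rpow (by positivity) hc0.le] at m3
    have e : (k : ℝ) ^ θ * c ^ θ * gapIntegral θ = growthCoeff θ x * (k : ℝ) ^ θ := by
      rw [growthCoeff, ← hc]; ring
    rw [e, abs_le] at m3
    rw [abs_le]
    constructor <;> linarith [m3.1, m3.2]
  · intro y hy z hz hyz
    have hy : 0 < y := hy
    have : z ^ (-(1 / θ)) ≤ y ^ (-(1 / θ)) :=
      Real.rpow_le_rpow_of_nonpos hy hyz (by linarith)
    simp only [hh]
    gcongr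

lemma growthCoeff_strictMono {θ x y : ℝ} (h0 : 0 < θ) (h1 : θ < 1) (hx : -1 < x) (hxy : x < y) :
    growthCoeff θ x < growthCoeff θ y := by
  have hα := one_lt_one_div_of_mem h0 h1
  have := hurwitzSeries_strictAnti hα (x := x + 1) (y := y + 1) (by linarith) (by linarith)
  have h2 := hurwitzSeries_pos hα (x := y + 1) (by linarith)
  have h3 := hurwitzSeries_pos hα (x := x + 1) (by linarith)
  have := gapIntegral_pos h0 h1
  unfold growthCoeff
  gcongr

lemma growthCoeff_mono {θ x y : ℝ} (h0 : 0 < θ) (h1 : θ < 1) (hx : -1 < x) (hxy : x ≤ y) :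
    growthCoeff θ x ≤ growthCoeff θ y := by
  rcases hxy.eq_or_lt with rfl | h
  · exact le_rfl
  · exact (growthCoeff_strictMono h0 h1 hx h).le

lemma continuousAt_growthCoeff {θ x : ℝ} (h0 : 0 < θ) (h1 : θ < 1) (hx : -1 < x) :
    ContinuousAt (fun t => growthCoeff t x) θ := by
  have hα := one_lt_one_div_of_mem h0 h1
  have h3 := hurwitzSeries_pos hα (x := x + 1) (by linarith)
  have hz : ContinuousAt (fun t => hurwitzSeries (1 / t) (x + 1)) θ :=
    ContinuousAt.comp (f := fun t : ℝ => 1 / t) (g := fun β => hurwitzSeries β (x + 1))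
      (continuousAt_hurwitzSeries_exponent hα (by linarith))
      (by simp only [one_div]; exact continuousAt_inv₀ h0.ne')
  exact (continuousAt_gapIntegral h0 h1).mul
    ((hz.inv₀ h3.ne').rpow continuousAt_id (Or.inl (inv_pos.2 h3).ne'))

/-! ### Monotonicity and continuity of the mean in the shift. -/

lemma pow_tangent_le {a b : ℝ} (ha : 0 ≤ a) (hb : 0 ≤ b) (k : ℕ) :
    k * b ^ (k - 1) * (a - b) ≤ a ^ k - b ^ k := by
  induction k with
  | zero => simp
  | succ k ih =>
    rcases k.eq_zero_or_pos with rfl | hk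
    · simp
    have e : b ^ k = b ^ (k - 1) * b := by rw [← pow_succ, Nat.sub_add_cancel hk]
    have l1 := mul_le_mul_of_nonneg_left ih ha
    have l2 : 0 ≤ k * b ^ (k - 1) * (a - b) ^ 2 := by positivity
    rw [Nat.add_sub_cancel, pow_succ, pow_succ]
    push_cast
    rw [e] at l1 ⊢
    linarith

/-- If the law `p'` crosses the law `p` once from below and is nonincreasing, a sample from `p'`
has more distinct values in the mean. -/
lemma tsum_one_sub_pow_le_of_crossing {p p' : ℕ → ℝ} (hp : ∀ i, 0 ≤ p i) (hp1 : ∀ i, p i ≤ 1)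
    (hp' : ∀ i, 0 ≤ p' i) (hp1' : ∀ i, p' i ≤ 1) (hs : HasSum p 1) (hs' : HasSum p' 1)
    (anti : Antitone p') (cross : ∀ i j, i ≤ j → p i ≤ p' i → p j ≤ p' j) (k : ℕ) :
    ∑' i, (1 - (1 - p i) ^ k) ≤ ∑' i, (1 - (1 - p' i) ^ k) := by
  have summ {r : ℕ → ℝ} (h0 : ∀ i, 0 ≤ r i) (h1 : ∀ i, r i ≤ 1) (h : HasSum r 1) :
      Summable fun i => 1 - (1 - r i) ^ k :=
    Summable.of_nonneg_of_le (fun i => one_sub_pow_nonneg (h0 i) (h1 i) k)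
      (fun i => one_sub_pow_le_mul (h1 i) k) (h.summable.mul_left _)
  have ex : ∃ i, p i ≤ p' i := by
    by_contra! hlt
    exact (hasSum_lt (i := 0) (fun i => (hlt i).le) (hlt 0) hs' hs).false
  classical
  set i₀ := Nat.find ex
  have hi₀ : p i₀ ≤ p' i₀ := Nat.find_spec ex
  -- Slope of `p ↦ 1 - (1 - p) ^ k` at `p' i`; by concavity it bounds the increments below. It is
  -- nondecreasing in `i`, while `p' - p` turns from negative to nonnegative at `i₀`, so replacing
  -- `g i` by `g i₀` only lowers each term.
  set g : ℕ → ℝ := fun i => k * (1 - p' i) ^ (k - 1) with hg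
  have key (i : ℕ) : g i₀ * (p' i - p i) ≤ (1 - (1 - p' i) ^ k) - (1 - (1 - p i) ^ k) := by
    have t := pow_tangent_le (sub_nonneg.2 (hp1 i)) (sub_nonneg.2 (hp1' i)) k
    have t2 : g i₀ * (p' i - p i) ≤ g i * (p' i - p i) := by
      rcases le_or_gt i₀ i with h | h
      · have hle : 1 - p' i₀ ≤ 1 - p' i := by linarith [anti h]
        have : g i₀ ≤ g i := by
          have := sub_nonneg.2 (hp1' i₀)
          simp only [hg]; gcongr
        exact mul_le_mul_of_nonneg_right this (sub_nonneg.2 (cross _ _ h hi₀))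
      · have hle : 1 - p' i ≤ 1 - p' i₀ := by linarith [anti h.le]
        have : g i ≤ g i₀ := by
          have := sub_nonneg.2 (hp1' i)
          simp only [hg]; gcongr
        have hneg : p' i < p i := not_le.1 (Nat.find_min ex h)
        nlinarith
    simp only [hg] at t2 ⊢
    linarith
  have s1 := summ hp' hp1' hs'
  have s2 := summ hp hp1 hs
  -- The lower bounds sum to `g i₀ * (1 - 1) = 0`.
  have := hasSum_le key ((hs'.sub hs).mul_left (g i₀)) (s1.hasSum.sub s2.hasSum)
  linarith

lemma zmProb_succ_eq (θ x : ℝ) (i : ℕ) : zmProb θ x (i + 1) =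
    (hurwitzSeries (1 / θ) (x + 1))⁻¹ * ((i : ℝ) + (x + 1)) ^ (-(1 / θ)) := by
  rw [zmProb, Nat.cast_succ, add_assoc, add_comm 1 x]

/-- The ratio of the law with shift `y` to the law with shift `x` is proportional to `((i + x + 1) /
(i + y + 1)) ^ (1 / θ)`, which increases with `i`; hence the laws cross once. -/
lemma meanDistinct_mono {θ x y : ℝ} (h0 : 0 < θ) (h1 : θ < 1) (hx : -1 < x) (hxy : x ≤ y)
    (k : ℕ) : meanDistinct θ x k ≤ meanDistinct θ y k := by
  have hy : -1 < y := hx.trans_le hxy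
  have hα := one_lt_one_div_of_mem h0 h1
  have hα0 : 0 < 1 / θ := by linarith
  have zx := hurwitzSeries_pos hα (x := x + 1) (by linarith)
  have zy := hurwitzSeries_pos hα (x := y + 1) (by linarith)
  refine tsum_one_sub_pow_le_of_crossing (fun i => (zmProb_pos h0 h1 hx i).le)
    (zmProb_le_one h0 h1 hx) (fun i => (zmProb_pos h0 h1 hy i).le) (zmProb_le_one h0 h1 hy)
    (hasSum_zmProb h0 h1 hx) (hasSum_zmProb h0 h1 hy) (fun i j hij => ?_) (fun i j hij hp => ?_) k
  · have hi := i.cast_nonneg (α := ℝ)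
    have hij : (i : ℝ) ≤ j := by exact_mod_cast hij
    simp only [zmProb_succ_eq]
    have := Real.rpow_le_rpow_of_nonpos (z := -(1 / θ)) (x := (i : ℝ) + (y + 1))
      (y := (j : ℝ) + (y + 1)) (by linarith) (by linarith) (by linarith)
    gcongr
  · have hi := i.cast_nonneg (α := ℝ)
    have hij : (i : ℝ) ≤ j := by exact_mod_cast hij
    rw [zmProb_succ_eq, zmProb_succ_eq] at hp ⊢
    have a1 : 0 < (i : ℝ) + (x + 1) := by linarith
    have a2 : 0 < (i : ℝ) + (y + 1) := by linarith
    have b1 : 0 < (j : ℝ) + (x + 1) := by linarith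
    have b2 : 0 < (j : ℝ) + (y + 1) := by linarith
    have r : (((i : ℝ) + (x + 1)) * ((j : ℝ) + (y + 1))) ^ (1 / θ) ≤
        (((i : ℝ) + (y + 1)) * ((j : ℝ) + (x + 1))) ^ (1 / θ) := by
      refine Real.rpow_le_rpow (by positivity) ?_ hα0.le
      nlinarith
    rw [Real.mul_rpow a1.le b2.le, Real.mul_rpow a2.le b1.le] at r
    simp only [Real.rpow_neg, a1.le, a2.le, b1.le, b2.le, ← div_eq_mul_inv] at hp ⊢
    have pa1 := Real.rpow_pos_of_pos a1 (1 / θ)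
    have pa2 := Real.rpow_pos_of_pos a2 (1 / θ)
    have pb1 := Real.rpow_pos_of_pos b1 (1 / θ)
    have pb2 := Real.rpow_pos_of_pos b2 (1 / θ)
    generalize ((i : ℝ) + (x + 1)) ^ (1 / θ) = A1 at *
    generalize ((i : ℝ) + (y + 1)) ^ (1 / θ) = A2 at *
    generalize ((j : ℝ) + (x + 1)) ^ (1 / θ) = B1 at *
    generalize ((j : ℝ) + (y + 1)) ^ (1 / θ) = B2 at *
    rw [div_le_div_iff₀ pa1 pa2] at hp
    rw [div_le_div_iff₀ pb1 pb2]
    have c1 := inv_pos.2 zx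
    have c2 := inv_pos.2 zy
    generalize (hurwitzSeries (1 / θ) (x + 1))⁻¹ = C1 at *
    generalize (hurwitzSeries (1 / θ) (y + 1))⁻¹ = C2 at *
    refine le_of_mul_le_mul_right ?_ (mul_pos pa1 pa2)
    calc C1 * B2 * (A1 * A2) = C1 * A2 * (A1 * B2) := by ring
      _ ≤ C2 * A1 * (A2 * B1) := by gcongr
      _ = C2 * B1 * (A1 * A2) := by ring

lemma continuousOn_meanDistinct {θ x₀ x₁ : ℝ} (h0 : 0 < θ) (h1 : θ < 1) (hx : -1 < x₀) (k : ℕ) :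
    ContinuousOn (fun x => meanDistinct θ x k) (Set.Icc x₀ x₁) := by
  have hα := one_lt_one_div_of_mem h0 h1
  have hz : ContinuousOn (fun x => hurwitzSeries (1 / θ) (x + 1)) (Set.Icc x₀ x₁) :=
    (continuousOn_hurwitzSeries_shift hα (x₀ := x₀ + 1) (by linarith)).comp
      (f := fun x => x + 1) (by fun_prop) fun x hx => by simpa using hx.1
  have hpos (x) (h : x ∈ Set.Icc x₀ x₁) : 0 < hurwitzSeries (1 / θ) (x + 1) :=
    hurwitzSeries_pos hα (by linarith [h.1])
  -- The majorant takes the normalizing constant at `x₁` and the power at `x₀`, where each is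
  -- largest.
  refine continuousOn_tsum (u := fun i : ℕ => k * ((hurwitzSeries (1 / θ) (x₁ + 1))⁻¹ *
    ((i : ℝ) + (x₀ + 1)) ^ (-(1 / θ)))) (fun i => ?_)
    (((summable_hurwitz hα (by linarith)).mul_left _).mul_left _) (fun i x hx' => ?_)
  · have : ContinuousOn (fun x => zmProb θ x (i + 1)) (Set.Icc x₀ x₁) := by
      simp only [zmProb_succ_eq]
      refine (hz.inv₀ fun x h => (hpos x h).ne').mul ?_
      refine ContinuousOn.rpow_const (by fun_prop) fun x h => Or.inl ?_
      have := h.1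
      have := i.cast_nonneg (α := ℝ)
      exact ne_of_gt (by linarith)
    fun_prop
  · have hx1 : -1 < x := hx.trans_le hx'.1
    have hi := i.cast_nonneg (α := ℝ)
    have p0 := (zmProb_pos h0 h1 hx1 i).le
    have p1 := zmProb_le_one h0 h1 hx1 i
    rw [Real.norm_of_nonneg (one_sub_pow_nonneg p0 p1 k)]
    refine (one_sub_pow_le_mul p1 k).trans ?_
    rw [zmProb_succ_eq]
    have l1 := Real.rpow_le_rpow_of_nonpos (z := -(1 / θ)) (x := (i : ℝ) + (x₀ + 1))
      (y := (i : ℝ) + (x + 1)) (by linarith) (by linarith [hx'.1]) (by linarith)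
    have l2 := hurwitzSeries_anti hα (x := x + 1) (y := x₁ + 1) (by linarith) (by linarith [hx'.2])
    have l3 := hurwitzSeries_pos hα (x := x₁ + 1) (by linarith [hx'.2])
    have l4 := hpos x hx'
    have l5 : 0 < (i : ℝ) + (x + 1) := by linarith
    have l6 := (Real.rpow_pos_of_pos l5 (-(1 / θ))).le
    gcongr

/-! ### Occupancy: negative correlation and Chebyshev's inequality. -/

/-- The event that the word `i` occurs among the first `k` words. -/
def occurs {Ω : Type*} (X : ℕ → Ω → ℕ) (k i : ℕ) : Set Ω := {ω | ∃ l ∈ Finset.range k, X l ω = i}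

lemma measurableSet_occurs {Ω : Type*} [MeasurableSpace Ω]
    {X : ℕ → Ω → ℕ} (hX : ∀ l, Measurable (X l)) (k i : ℕ) :
    MeasurableSet (occurs X k i) := by
  have : occurs X k i = ⋃ l ∈ Finset.range k, X l ⁻¹' {i} := by
    ext ω; simp [occurs]
  rw [this]
  exact Finset.measurableSet_biUnion _ fun l _ => hX l (measurableSet_singleton i)

lemma numDistinct_eq_tsum {Ω : Type*} (X : ℕ → Ω → ℕ) (k : ℕ) (ω : Ω) :
    (numDistinct (fun j => X j ω) k : ENNReal) =
      ∑' i, (occurs X k i).indicator (fun _ => (1 : ENNReal)) ω := by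
  rw [tsum_eq_sum (s := (Finset.range k).image fun j => X j ω)]
  · rw [numDistinct, Finset.card_eq_sum_ones, Nat.cast_sum]
    refine Finset.sum_congr rfl fun i hi => ?_
    rw [Set.indicator_of_mem]
    · simp
    · simpa [occurs] using hi
  · intro i hi
    refine Set.indicator_of_notMem ?_ _
    simpa [occurs] using hi

lemma numDistinct_le (w : ℕ → ℕ) (k : ℕ) : numDistinct w k ≤ k :=
  Finset.card_image_le.trans (Finset.card_range k).le

lemma measurable_numDistinct {Ω : Type*} [MeasurableSpace Ω]
    {X : ℕ → Ω → ℕ} (hX : ∀ l, Measurable (X l)) (k : ℕ) :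
    Measurable fun ω => (numDistinct (fun j => X j ω) k : ENNReal) := by
  simp only [numDistinct_eq_tsum]
  exact Measurable.tsum fun i => measurable_const.indicator (measurableSet_occurs hX k i)

lemma measureReal_forall_mem {Ω : Type*} [MeasurableSpace Ω]
    {P : Measure Ω} [IsProbabilityMeasure P] {X : ℕ → Ω → ℕ}
    (hind : iIndepFun X P) {S : Set ℕ} {s : ℝ}
    (hs : ∀ l, P.real (X l ⁻¹' S) = s) (k : ℕ) :
    P.real (⋂ l ∈ Finset.range k, X l ⁻¹' S) = s ^ k := by
  have := hind.measure_inter_preimage_eq_mul (Finset.range k) (sets := fun _ => S)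
    (fun l _ => MeasurableSet.of_discrete)
  rw [Measure.real, this, ENNReal.toReal_prod]
  simp only [← measureReal_def, hs, Finset.prod_const, Finset.card_range]

lemma measureReal_occurs_compl {Ω : Type*} [MeasurableSpace Ω] {P : Measure Ω} [IsProbabilityMeasure P]
    {X : ℕ → Ω → ℕ} {p : ℕ → ℝ} (hX : ∀ l, Measurable (X l)) (hind : iIndepFun X P)
    (hp : ∀ l i, P.real (X l ⁻¹' {i}) = p i)
    (k i : ℕ) : P.real (occurs X k i)ᶜ = (1 - p i) ^ k := by
  rw [← measureReal_forall_mem hind (S := {i}ᶜ) (s := 1 - p i) (fun l => ?_) k]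
  · congr 1
    ext ω; simp [occurs]
  · rw [Set.preimage_compl, probReal_compl_eq_one_sub (hX l (measurableSet_singleton i)), hp]

lemma measureReal_occurs {Ω : Type*} [MeasurableSpace Ω] {P : Measure Ω} [IsProbabilityMeasure P]
    {X : ℕ → Ω → ℕ} {p : ℕ → ℝ} (hX : ∀ l, Measurable (X l)) (hind : iIndepFun X P)
    (hp : ∀ l i, P.real (X l ⁻¹' {i}) = p i)
    (k i : ℕ) : P.real (occurs X k i) = 1 - (1 - p i) ^ k := by
  rw [← measureReal_occurs_compl hX hind hp, probReal_compl_eq_one_sub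
    (measurableSet_occurs hX k i), sub_sub_cancel]

/-- Passing to complements, this is `(1 - p i - p j) ^ k ≤ ((1 - p i) * (1 - p j)) ^ k`. -/
lemma measureReal_occurs_inter_le {Ω : Type*} [MeasurableSpace Ω] {P : Measure Ω} [IsProbabilityMeasure P]
    {X : ℕ → Ω → ℕ} {p : ℕ → ℝ} (hX : ∀ l, Measurable (X l)) (hind : iIndepFun X P)
    (hp : ∀ l i, P.real (X l ⁻¹' {i}) = p i)
    (k : ℕ) {i j : ℕ} (hij : i ≠ j) :
    P.real (occurs X k i ∩ occurs X k j) ≤ P.real (occurs X k i) * P.real (occurs X k j) := by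
  have hpair (l : ℕ) : P.real (X l ⁻¹' {i, j}) = p i + p j := by
    rw [← hp l i, ← hp l j, ← measureReal_union _ (hX l (measurableSet_singleton j)),
      ← Set.preimage_union, Set.singleton_union]
    exact Disjoint.preimage _ (by simpa using hij)
  have h1 : p i + p j ≤ 1 := hpair 0 ▸ measureReal_le_one
  have hi0 : 0 ≤ p i := hp 0 i ▸ measureReal_nonneg
  have hj0 : 0 ≤ p j := hp 0 j ▸ measureReal_nonneg
  have hboth : P.real ((occurs X k i)ᶜ ∩ (occurs X k j)ᶜ) = (1 - (p i + p j)) ^ k := by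
    rw [← measureReal_forall_mem hind (S := {i, j}ᶜ) (s := 1 - (p i + p j)) (fun l => ?_) k]
    · congr 1
      ext ω
      simp only [occurs, Set.mem_inter_iff, Set.mem_compl_iff, Set.mem_ofPred_eq, not_exists,
        not_and, Set.mem_iInter, Set.mem_preimage, Set.mem_insert_iff, Set.mem_singleton_iff,
        not_or]
      exact ⟨fun h l hl => ⟨h.1 l hl, h.2 l hl⟩, fun h => ⟨fun l hl => (h l hl).1,
        fun l hl => (h l hl).2⟩⟩
    · rw [Set.preimage_compl, probReal_compl_eq_one_sub (hX l MeasurableSet.of_discrete), hpair]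
  have hu : P.real (occurs X k i ∪ occurs X k j) = 1 - (1 - (p i + p j)) ^ k := by
    rw [← hboth, ← Set.compl_union, probReal_compl_eq_one_sub
      ((measurableSet_occurs hX k i).union (measurableSet_occurs hX k j)), sub_sub_cancel]
  have hincl := measureReal_union_add_inter (μ := P) (s := occurs X k i)
    (measurableSet_occurs hX k j)
  rw [hu] at hincl
  have hpow : (1 - (p i + p j)) ^ k ≤ (1 - p i) ^ k * (1 - p j) ^ k := by
    rw [← mul_pow]
    exact pow_le_pow_left₀ (by linarith) (by nlinarith [mul_nonneg hi0 hj0]) k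
  rw [measureReal_occurs hX hind hp, measureReal_occurs hX hind hp] at hincl ⊢
  nlinarith

lemma measure_occurs_inter_le {Ω : Type*} [MeasurableSpace Ω] {P : Measure Ω} [IsProbabilityMeasure P]
    {X : ℕ → Ω → ℕ} {p : ℕ → ℝ} (hX : ∀ l, Measurable (X l)) (hind : iIndepFun X P)
    (hp : ∀ l i, P.real (X l ⁻¹' {i}) = p i)
    (k : ℕ) {i j : ℕ} (hij : i ≠ j) :
    P (occurs X k i ∩ occurs X k j) ≤ P (occurs X k i) * P (occurs X k j) := by
  have := measureReal_occurs_inter_le hX hind hp k hij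
  rw [Measure.real, Measure.real, Measure.real, ← ENNReal.toReal_mul] at this
  exact (ENNReal.toReal_le_toReal (measure_ne_top _ _)
    (ENNReal.mul_ne_top (measure_ne_top _ _) (measure_ne_top _ _))).1 this

lemma lintegral_numDistinct {Ω : Type*} [MeasurableSpace Ω] {P : Measure Ω}
    {X : ℕ → Ω → ℕ} (hX : ∀ l, Measurable (X l)) (k : ℕ) :
    ∫⁻ ω, (numDistinct (fun j => X j ω) k : ENNReal) ∂P = ∑' i, P (occurs X k i) := by
  simp only [numDistinct_eq_tsum]
  rw [lintegral_tsum fun i =>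
    (measurable_const.indicator (measurableSet_occurs hX k i)).aemeasurable]
  refine tsum_congr fun i => ?_
  rw [lintegral_indicator_const (measurableSet_occurs hX k i), one_mul]

/-- The diagonal pairs give the mean, and negative correlation bounds the others by products, so the
variance is at most the mean. -/
lemma lintegral_numDistinct_sq_le {Ω : Type*} [MeasurableSpace Ω] {P : Measure Ω} [IsProbabilityMeasure P]
    {X : ℕ → Ω → ℕ} {p : ℕ → ℝ} (hX : ∀ l, Measurable (X l)) (hind : iIndepFun X P)
    (hp : ∀ l i, P.real (X l ⁻¹' {i}) = p i)
    (k : ℕ) :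
    ∫⁻ ω, (numDistinct (fun j => X j ω) k : ENNReal) ^ 2 ∂P ≤
      ∑' i, P (occurs X k i) + (∑' i, P (occurs X k i)) ^ 2 := by
  have e (ω : Ω) : (numDistinct (fun j => X j ω) k : ENNReal) ^ 2 =
      ∑' i, ∑' j, (occurs X k i ∩ occurs X k j).indicator (fun _ => (1 : ENNReal)) ω := by
    rw [numDistinct_eq_tsum, sq, ← ENNReal.tsum_mul_right]
    refine tsum_congr fun i => ?_
    rw [← ENNReal.tsum_mul_left]
    refine tsum_congr fun j => ?_
    rw [← Set.indicator_mul_left]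
    by_cases hi : ω ∈ occurs X k i <;> by_cases hj : ω ∈ occurs X k j <;> simp [hi, hj]
  have ms (i j : ℕ) := (measurableSet_occurs hX k i).inter (measurableSet_occurs hX k j)
  simp only [e]
  rw [lintegral_tsum fun i => (Measurable.tsum fun j =>
    measurable_const.indicator (ms i j)).aemeasurable]
  simp_rw [lintegral_tsum fun j => (measurable_const.indicator (ms _ j)).aemeasurable,
    lintegral_indicator_const (ms _ _), one_mul]
  calc ∑' i, ∑' j, P (occurs X k i ∩ occurs X k j)
      ≤ ∑' i, ∑' j, ((if j = i then P (occurs X k i) else 0) +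
          P (occurs X k i) * P (occurs X k j)) := by
        refine ENNReal.tsum_le_tsum fun i => ENNReal.tsum_le_tsum fun j => ?_
        split_ifs with h
        · exact (measure_mono Set.inter_subset_left).trans le_self_add
        · rw [zero_add]
          exact measure_occurs_inter_le hX hind hp k (Ne.symm h)
    _ = _ := by
        simp_rw [ENNReal.tsum_add, tsum_ite_eq, ENNReal.tsum_mul_left, ENNReal.tsum_mul_right, sq]

lemma measure_abs_numDistinct_sub_ge_le {Ω : Type*} [MeasurableSpace Ω] {P : Measure Ω} [IsProbabilityMeasure P]
    {X : ℕ → Ω → ℕ} {p : ℕ → ℝ} (hX : ∀ l, Measurable (X l)) (hind : iIndepFun X P)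
    (hp : ∀ l i, P.real (X l ⁻¹' {i}) = p i)
    (k : ℕ) {m t : ℝ} (ht : 0 < t)
    (hm : HasSum (fun i => 1 - (1 - p i) ^ k) m) :
    P {ω | t ≤ |(numDistinct (fun j => X j ω) k : ℝ) - m|} ≤ ENNReal.ofReal (m / t ^ 2) := by
  set R : Ω → ℝ := fun ω => (numDistinct (fun j => X j ω) k : ℝ) with hR
  have hRm : Measurable R := by
    simpa using (measurable_numDistinct hX k).ennreal_toReal
  have hR2 : MemLp R 2 P := MemLp.of_bound hRm.aestronglyMeasurable k (ae_of_all _ fun ω => by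
    rw [Real.norm_of_nonneg (by positivity)]
    exact Nat.cast_le.2 (numDistinct_le _ k))
  have hm0 : 0 ≤ m := hm.nonneg fun i => measureReal_occurs hX hind hp k i ▸ measureReal_nonneg
  have hsum : ∑' i, P (occurs X k i) = ENNReal.ofReal m := by
    rw [← hm.tsum_eq, ENNReal.ofReal_tsum_of_nonneg
      (fun i => measureReal_occurs hX hind hp k i ▸ measureReal_nonneg) hm.summable]
    refine tsum_congr fun i => ?_
    rw [← measureReal_occurs hX hind hp, ofReal_measureReal]
  have hmean : P[R] = m := by
    rw [integral_eq_lintegral_of_nonneg_ae (ae_of_all _ fun ω => by positivity)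
      hRm.aestronglyMeasurable]
    simp only [hR, ENNReal.ofReal_natCast]
    rw [lintegral_numDistinct hX, hsum, ENNReal.toReal_ofReal hm0]
  have hsq : P[R ^ 2] ≤ m + m ^ 2 := by
    change ∫ ω, R ω ^ 2 ∂P ≤ _
    rw [integral_eq_lintegral_of_nonneg_ae (ae_of_all _ fun ω => by positivity)
      (hRm.pow_const 2).aestronglyMeasurable]
    refine ENNReal.toReal_le_of_le_ofReal (by positivity) ?_
    have := lintegral_numDistinct_sq_le hX hind hp k
    rw [hsum, ← ENNReal.ofReal_pow hm0, ← ENNReal.ofReal_add hm0 (by positivity)] at this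
    refine le_trans (le_of_eq (lintegral_congr fun ω => ?_)) this
    simp only [hR]
    rw [ENNReal.ofReal_pow (by positivity), ENNReal.ofReal_natCast]
  have := meas_ge_le_variance_div_sq hR2 ht
  rw [hmean] at this
  refine this.trans (ENNReal.ofReal_le_ofReal ?_)
  rw [variance_eq_sub hR2, hmean]
  gcongr
  linarith

/-- The law is prescribed only for `i ≥ 1`; those probabilities already sum to 1, so the number 0
has probability zero. -/
lemma IsZMText.measureReal_eq {Ω : Type*} [MeasurableSpace Ω]
    {P : Measure Ω} {X : ℕ → Ω → ℕ} {θ q : ℝ}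
    (h : IsZMText P X θ q) (h0 : 0 < θ) (h1 : θ < 1) (hq : -1 < q) (l i : ℕ) :
    P.real (X l ⁻¹' {i}) = if i = 0 then 0 else zmProb θ q i := by
  have := h.prob
  have hpos (i : ℕ) : P.real (X l ⁻¹' {i + 1}) = zmProb θ q (i + 1) := by
    have := h.law l (i + 1) (by omega)
    rw [Measure.real]
    change (P {ω | X l ω = i + 1}).toReal = _
    rw [this, ENNReal.toReal_ofReal (zmProb_pos h0 h1 hq i).le]
  cases i with
  | succ i => simpa using hpos i
  | zero =>
    have hs : HasSum (fun i => P.real (X l ⁻¹' {i})) 1 := by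
      have e : ∑' i, P (X l ⁻¹' {i}) = 1 := by
        rw [← measure_iUnion (fun i j hij => Disjoint.preimage _ (by simpa using hij))
          (fun i => h.meas l (measurableSet_singleton i)), ← Set.preimage_iUnion,
          Set.iUnion_singleton_eq_range]
        simp
      have := (ENNReal.hasSum_toReal (f := fun i => P (X l ⁻¹' {i})) (by rw [e]; simp))
      rwa [← ENNReal.tsum_toReal_eq (fun _ => measure_ne_top _ _), e, ENNReal.toReal_one] at this
    have h2 := (hasSum_nat_add_iff' 1).2 hs
    simp only [hpos, Finset.sum_range_one] at h2
    have := h2.unique (hasSum_zmProb h0 h1 hq)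
    simp only [if_true]
    linarith

lemma IsZMText.measure_deviation_le {Ω : Type*} [MeasurableSpace Ω]
    {P : Measure Ω} {X : ℕ → Ω → ℕ} {θ q : ℝ}
    (h : IsZMText P X θ q) (h0 : 0 < θ) (h1 : θ < 1) (hq : -1 < q) (k : ℕ) {t : ℝ} (ht : 0 < t) :
    P {ω | t ≤ |(numDistinct (fun j => X j ω) k : ℝ) - meanDistinct θ q k|} ≤
      ENNReal.ofReal (meanDistinct θ q k / t ^ 2) := by
  have := h.prob
  refine measure_abs_numDistinct_sub_ge_le h.meas h.indep
    (p := fun i => if i = 0 then 0 else zmProb θ q i) (h.measureReal_eq h0 h1 hq) k ht ?_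
  rw [← hasSum_nat_add_iff' 1]
  simpa [meanDistinct] using (summable_meanDistinct h0 h1 hq k).hasSum

/-! ### Weights as functionals of finite variation. -/

/-- `T` is constant on the intervals that avoid the finite set `G`. -/
def IsStepOff (T : ℝ → ℝ) (G : Finset ℝ) : Prop :=
  ∀ x y, x ≤ y → (∀ z ∈ G, z ∉ Set.Icc x y) → T x = T y

lemma exists_gap (G : Finset ℝ) (x : ℝ) : ∃ ε > 0, ∀ z ∈ G, z ≠ x → ε ≤ |z - x| := by
  have h : ((G.erase x : Finset ℝ) : Set ℝ)ᶜ ∈ 𝓝 x :=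
    (G.erase x).finite_toSet.isClosed.isOpen_compl.mem_nhds (by simp)
  obtain ⟨ε, hε, hb⟩ := Metric.mem_nhds_iff.1 h
  refine ⟨ε, hε, fun z hz hzx => ?_⟩
  by_contra! hlt
  exact hb (Metric.mem_ball.2 (by rwa [Real.dist_eq])) (by simp [hz, hzx])

/-- `Function.leftLim` falls back on the value at the point when there is no limit, so jumps have
their meaning only once the one-sided limits exist. -/
lemma IsStepOff.exists_left {T : ℝ → ℝ} {G : Finset ℝ} (h : IsStepOff T G) (x : ℝ) :
    ∃ l, ∀ᶠ t in 𝓝[<] x, T t = l := by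
  obtain ⟨ε, hε, hG⟩ := exists_gap G x
  have key (s t : ℝ) (hs : x - ε < s) (hst : s ≤ t) (ht : t < x) : T s = T t :=
    h s t hst fun z hz hzI => by
      have := hG z hz (by linarith [hzI.2] : z < x).ne
      rw [abs_of_neg (by linarith [hzI.2])] at this
      linarith [hzI.1]
  refine ⟨T (x - ε / 2), ?_⟩
  filter_upwards [Ioo_mem_nhdsLT (show x - ε < x by linarith)] with t ht
  rcases le_total t (x - ε / 2) with h' | h'
  · exact key _ _ ht.1 h' (by linarith)
  · exact (key _ _ (by linarith) h' ht.2).symm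

lemma IsStepOff.exists_right {T : ℝ → ℝ} {G : Finset ℝ} (h : IsStepOff T G) (x : ℝ) :
    ∃ r, ∀ᶠ t in 𝓝[>] x, T t = r := by
  obtain ⟨ε, hε, hG⟩ := exists_gap G x
  have key (s t : ℝ) (hs : x < s) (hst : s ≤ t) (ht : t < x + ε) : T s = T t :=
    h s t hst fun z hz hzI => by
      have := hG z hz (by linarith [hzI.1] : x < z).ne'
      rw [abs_of_pos (by linarith [hzI.1])] at this
      linarith [hzI.2]
  refine ⟨T (x + ε / 2), ?_⟩
  filter_upwards [Ioo_mem_nhdsGT (show x < x + ε by linarith)] with t ht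
  rcases le_total t (x + ε / 2) with h' | h'
  · exact key _ _ ht.1 h' (by linarith)
  · exact (key _ _ (by linarith) h' ht.2).symm

lemma IsStepOff.eventually_eq {T : ℝ → ℝ} {G : Finset ℝ} (h : IsStepOff T G) {x : ℝ}
    (hx : x ∉ G) : ∀ᶠ t in 𝓝 x, T t = T x := by
  obtain ⟨ε, hε, hG⟩ := exists_gap G x
  filter_upwards [Metric.ball_mem_nhds x hε] with t ht
  rw [Metric.mem_ball, Real.dist_eq, abs_lt] at ht
  have hG' (z) (hz : z ∈ G) : ε ≤ |z - x| := hG z hz fun e => hx (e ▸ hz)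
  rcases le_total t x with h' | h'
  · refine h _ _ h' fun z hz hzI => ?_
    have := hG' z hz
    rw [abs_of_nonpos (by linarith [hzI.2])] at this
    linarith [hzI.1]
  · refine (h _ _ h' fun z hz hzI => ?_).symm
    have := hG' z hz
    rw [abs_of_nonneg (by linarith [hzI.1])] at this
    linarith [hzI.2]

lemma leftLim_eq_of_eventually {T : ℝ → ℝ} {x l : ℝ} (h : ∀ᶠ t in 𝓝[<] x, T t = l) :
    Function.leftLim T x = l :=
  leftLim_eq_of_tendsto (tendsto_const_nhds.congr' (h.mono fun _ ht => ht.symm))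

lemma rightLim_eq_of_eventually {T : ℝ → ℝ} {x l : ℝ} (h : ∀ᶠ t in 𝓝[>] x, T t = l) :
    Function.rightLim T x = l :=
  rightLim_eq_of_tendsto (tendsto_const_nhds.congr' (h.mono fun _ ht => ht.symm))

/-- The jump `T(x+) - T(x-)`. -/
def jump (T : ℝ → ℝ) (x : ℝ) : ℝ := Function.rightLim T x - Function.leftLim T x

lemma sum_jump_eq (G : Finset ℝ) : ∀ {T : ℝ → ℝ}, IsStepOff T G → ∀ {x y : ℝ}, x ≤ y →
    (∀ z ∈ G, x < z) → (∀ z ∈ G, z < y) → ∑ z ∈ G, jump T z = T y - T x := by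
  classical
  induction G using Finset.induction_on_max with
  | empty => intro T hT x y hxy _ _; simp [hT x y hxy (by simp)]
  | insert M G hM ih =>
    intro T hT x y hxy hx hy
    have hxM : x < M := hx M (Finset.mem_insert_self _ _)
    have hMy : M < y := hy M (Finset.mem_insert_self _ _)
    -- Induction on the largest breakpoint `M`: freezing `T` at its left limit from `M` on removes
    -- this breakpoint and keeps the earlier jumps.
    set T' : ℝ → ℝ := fun t => if t < M then T t else Function.leftLim T M with hT'
    have hstep : IsStepOff T' G := by
      intro u v huv hG
      simp only [hT']
      split_ifs with h1 h2 h2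
      · refine hT u v huv fun z hz hzI => ?_
        rcases Finset.mem_insert.1 hz with rfl | hz
        · exact absurd hzI.2 (not_le.2 h2)
        · exact hG z hz hzI
      · refine (leftLim_eq_of_eventually ?_).symm
        filter_upwards [Ioo_mem_nhdsLT h1] with t ht
        refine (hT u t ht.1.le fun z hz hzI => ?_).symm
        rcases Finset.mem_insert.1 hz with rfl | hz
        · exact absurd hzI.2 (not_le.2 ht.2)
        · exact hG z hz ⟨hzI.1, hzI.2.trans (ht.2.le.trans (not_lt.1 h2))⟩
      · exact absurd (huv.trans_lt h2) h1
      · rfl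
    have hj (z) (hz : z ∈ G) : jump T z = jump T' z := by
      have hzM := hM z hz
      have hnear : ∀ᶠ t in 𝓝 z, T' t = T t := by
        filter_upwards [Iio_mem_nhds hzM] with t ht
        simp only [hT', if_pos (show t < M from ht)]
      obtain ⟨l, hl⟩ := hT.exists_left z
      obtain ⟨r, hr⟩ := hT.exists_right z
      rw [jump, jump, leftLim_eq_of_eventually hl, rightLim_eq_of_eventually hr,
        leftLim_eq_of_eventually (l := l), rightLim_eq_of_eventually (l := r)]
      · filter_upwards [hr, hnear.filter_mono nhdsWithin_le_nhds] with t h1 h2 using h2.trans h1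
      · filter_upwards [hl, hnear.filter_mono nhdsWithin_le_nhds] with t h1 h2 using h2.trans h1
    rw [Finset.sum_insert fun h => (hM M h).false, Finset.sum_congr rfl hj, ih hstep hxy
      (fun z hz => hx z (Finset.mem_insert_of_mem hz))
      (fun z hz => hy z (Finset.mem_insert_of_mem hz))]
    have hTy : Function.rightLim T M = T y := by
      refine rightLim_eq_of_eventually ?_
      filter_upwards [Ioo_mem_nhdsGT hMy] with t ht
      refine hT t y ht.2.le fun z hz hzI => ?_
      rcases Finset.mem_insert.1 hz with rfl | hz
      · exact absurd hzI.1 (not_le.2 ht.1)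
      · exact absurd (hzI.1.trans (hM z hz).le) (not_le.2 ht.1)
    simp only [hT', if_pos hxM, if_neg (not_lt.2 hMy.le), jump, hTy]
    ring

/-- `B` extended continuously by constants from `[0,1]` to the line. -/
def clampExtend (B : ℝ → ℝ) (t : ℝ) : ℝ := B (max 0 (min 1 t))

lemma clampExtend_of_mem {B : ℝ → ℝ} {t : ℝ} (h0 : 0 ≤ t) (h1 : t ≤ 1) :
    clampExtend B t = B t := by
  rw [clampExtend, min_eq_right h1, max_eq_right h0]

lemma continuous_clampExtend {B : ℝ → ℝ} (hB : ContinuousOn B (Set.Icc 0 1)) :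
    Continuous (clampExtend B) :=
  hB.comp_continuous (by fun_prop) fun t => ⟨le_max_left _ _, max_le zero_le_one (min_le_left _ _)⟩

/-- A weight is the sum of a step function and a continuous function that is continuously
differentiable between the points of a finite set, with bounded derivative. -/
lemma IsWeight.exists_decomposition {A : ℝ → ℝ} (hA : IsWeight A) :
    ∃ (G : Finset ℝ) (T B : ℝ → ℝ) (K : ℝ), (∀ t, A t = T t + B t) ∧ IsStepOff T G ∧
      Continuous B ∧ (∀ t ∈ Set.Ioo (0 : ℝ) 1, t ∉ G → HasDerivAt B (deriv B t) t) ∧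
      (∀ t ∈ Set.Ioo (0 : ℝ) 1, t ∉ G → |deriv B t| ≤ K) ∧
      (∀ t, t ≤ 0 → B t = B 0) ∧ (∀ t, 1 ≤ t → B t = B 1) := by
  classical
  obtain ⟨S, B, ⟨F, hF⟩, ⟨hBc, F', hF'⟩, hAeq⟩ := hA.regular
  obtain ⟨δ, hδ0, hδ1, hδ⟩ := hA.zero_left
  have hB0 (t : ℝ) (ht : t ≤ 0) : clampExtend B t = B 0 := by
    rw [clampExtend, min_eq_right (by linarith), max_eq_left ht]
  have hB1 (t : ℝ) (ht : 1 ≤ t) : clampExtend B t = B 1 := by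
    rw [clampExtend, min_eq_left ht, max_eq_right zero_le_one]
  have hCnear {t : ℝ} (ht : t ∈ Set.Ioo (0 : ℝ) 1) : clampExtend B =ᶠ[𝓝 t] B := by
    filter_upwards [Ioo_mem_nhds ht.1 ht.2] with s hs using clampExtend_of_mem hs.1.le hs.2.le
  have hpiece {x y t : ℝ} (hx : 0 ≤ x) (hxt : x < t) (hty : t < y) (hy : y ≤ 1)
      (hav : ∀ z ∈ F', z ∉ Set.Ioo x y) :
      HasDerivAt B (derivWithin B (Set.Icc x y) t) t :=
    (((hF' x y hx (hxt.trans hty) hy hav).differentiableOn one_ne_zero)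
      t (⟨hxt.le, hty.le⟩ : t ∈ Set.Icc x y)).hasDerivWithinAt.hasDerivAt
      (Icc_mem_nhds hxt hty)
  have hbd : ∃ K, ∀ t ∈ Set.Ioo (0 : ℝ) 1, t ∉ F' → |deriv B t| ≤ K := by
    -- Compactness reduces the bound to a neighbourhood of each point. There the two sides are `C¹`
    -- pieces with derivatives bounded up to the end, and the point itself is treated separately.
    have := isCompact_Icc (a := (0 : ℝ)) (b := 1) |>.induction_on
      (p := fun s => ∃ K, ∀ t ∈ s, t ∈ Set.Ioo (0 : ℝ) 1 → t ∉ F' → |deriv B t| ≤ K)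
      ⟨0, by simp⟩ (fun s t hst ⟨K, hK⟩ => ⟨K, fun u hu => hK u (hst hu)⟩)
      (fun s t ⟨K, hK⟩ ⟨L, hL⟩ => ⟨max K L, fun u hu h1 h2 => hu.elim
        (fun h => (hK u h h1 h2).trans (le_max_left _ _))
        (fun h => (hL u h h1 h2).trans (le_max_right _ _))⟩) (fun x hx => ?_)
    · obtain ⟨K, hK⟩ := this
      exact ⟨K, fun t ht => hK t ⟨ht.1.le, ht.2.le⟩ ht⟩
    · obtain ⟨ε, hε, hG⟩ := exists_gap F' x
      have hav {u v : ℝ} (hu : x - ε ≤ u) (hv : v ≤ x + ε) (huv : v ≤ x ∨ x ≤ u) :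
          ∀ z ∈ F', z ∉ Set.Ioo u v := fun z hz hzI => by
        have hne : z ≠ x := by
          rcases huv with h | h
          · exact (hzI.2.trans_le h).ne
          · exact (h.trans_lt hzI.1).ne'
        have h1 := hG z hz hne
        have h2 : |z - x| < ε := abs_lt.2 ⟨by linarith [hzI.1], by linarith [hzI.2]⟩
        exact absurd h1 (not_le.2 h2)
      have hbound {u v : ℝ} (hu0 : 0 ≤ u) (hv1 : v ≤ 1) (hav : ∀ z ∈ F', z ∉ Set.Ioo u v) :
          ∃ K, ∀ t ∈ Set.Ioo u v, |deriv B t| ≤ K := by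
        rcases le_or_gt v u with h | h
        · exact ⟨0, fun t ht => absurd (ht.1.trans ht.2) (not_lt.2 h)⟩
        obtain ⟨K, hK⟩ := isCompact_Icc.exists_bound_of_continuousOn
          ((hF' u v hu0 h hv1 hav).continuousOn_derivWithin (uniqueDiffOn_Icc h) le_rfl)
        exact ⟨K, fun t ht => by
          rw [(hpiece hu0 ht.1 ht.2 hv1 hav).deriv]
          exact hK t ⟨ht.1.le, ht.2.le⟩⟩
      obtain ⟨K, hK⟩ := hbound (u := max 0 (x - ε)) (v := x) (le_max_left _ _) hx.2
        (hav (le_max_right _ _) (by linarith) (Or.inl le_rfl))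
      obtain ⟨L, hL⟩ := hbound (u := x) (v := min 1 (x + ε)) hx.1 (min_le_left _ _)
        (hav (by linarith) (min_le_right _ _) (Or.inr le_rfl))
      refine ⟨Set.Ioo (x - ε) (x + ε),
        mem_nhdsWithin_of_mem_nhds (Ioo_mem_nhds (by linarith) (by linarith)),
        max (max K L) |deriv B x|, fun t ht h1 _ => ?_⟩
      rcases lt_trichotomy t x with h | rfl | h
      · exact (hK t ⟨max_lt h1.1 ht.1, h⟩).trans ((le_max_left _ _).trans (le_max_left _ _))
      · exact le_max_right _ _
      · exact (hL t ⟨h, lt_min h1.2 ht.2⟩).trans ((le_max_right _ _).trans (le_max_left _ _))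
  obtain ⟨K, hK⟩ := hbd
  -- The ends 0 and 1 become breakpoints because the zero extension of `A` may make the step part
  -- jump there.
  refine ⟨F ∪ F' ∪ {0, 1}, fun t => A t - clampExtend B t, clampExtend B, K,
    fun t => (sub_add_cancel _ _).symm, ?_, continuous_clampExtend hBc, ?_, ?_,
    fun t ht => (hB0 t ht).trans (hB0 0 le_rfl).symm,
    fun t ht => (hB1 t ht).trans (hB1 1 le_rfl).symm⟩
  · intro x y hxy hG
    have h0 := hG 0 (by simp)
    have h1 := hG 1 (by simp)
    rw [Set.mem_Icc, not_and_or, not_le, not_le] at h0 h1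
    rcases h0 with h0 | h0
    · rcases h1 with h1 | h1
      · simp only [hA.zero_right x h1.le, hA.zero_right y (by linarith), hB1 x h1.le,
          hB1 y (by linarith)]
      · have hx1 : x ≤ 1 := by linarith
        have hy0 : 0 ≤ y := by linarith
        simp only [clampExtend_of_mem h0.le hx1, clampExtend_of_mem hy0 h1.le,
          hAeq x ⟨h0.le, hx1⟩, hAeq y ⟨hy0, h1.le⟩, add_sub_cancel_right]
        exact hF x y h0.le hxy h1.le fun z hz => hG z (by simp [hz])
    · simp only [hδ x (by linarith), hδ y (by linarith), hB0 x (by linarith), hB0 y h0.le]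
  · intro t ht htG
    have htF : t ∉ F' := fun h => htG (by simp [h])
    obtain ⟨ε, hε, hG⟩ := exists_gap F' t
    have hd := hpiece (x := max 0 (t - ε)) (y := min 1 (t + ε)) (t := t) (le_max_left _ _)
      (max_lt ht.1 (by linarith)) (lt_min ht.2 (by linarith)) (min_le_left _ _)
      fun z hz hzI => by
        have h1 := hG z hz fun e => htF (e ▸ hz)
        have h2 := (le_max_right _ _).trans_lt hzI.1
        have h3 := hzI.2.trans_le (min_le_right _ _)
        exact absurd h1 (not_le.2 (abs_lt.2 ⟨by linarith, by linarith⟩))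
    exact (hd.congr_of_eventuallyEq (hCnear ht)).differentiableAt.hasDerivAt
  · intro t ht htG
    rw [(hCnear ht).deriv_eq]
    exact hK t ht fun h => htG (by simp [h])

/-- The integration functional of a weight: total mass zero and finite variation. -/
lemma IsWeight.exists_jumps {A : ℝ → ℝ} (hA : IsWeight A) :
    ∃ (G : Finset ℝ) (K : ℝ), 0 ≤ K ∧ (∀ x ∉ G, jump A x = 0) ∧
      (∀ᵐ t, t ∈ Set.uIoc (0 : ℝ) 1 → |deriv A t| ≤ K) ∧
      (∑ x ∈ G, jump A x) + ∫ t in (0 : ℝ)..1, deriv A t = 0 := by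
  classical
  obtain ⟨G, T, B, K, hAeq, hT, hBc, hBd, hK, hB0, hB1⟩ := hA.exists_decomposition
  obtain ⟨δ, hδ0, hδ1, hδ⟩ := hA.zero_left
  have hjump (x : ℝ) : jump A x = jump T x := by
    obtain ⟨l, hl⟩ := hT.exists_left x
    obtain ⟨r, hr⟩ := hT.exists_right x
    have el : Function.leftLim A x = l + B x := leftLim_eq_of_tendsto
      (((tendsto_const_nhds.congr' (hl.mono fun _ ht => ht.symm)).add
        (hBc.continuousAt.tendsto.mono_left nhdsWithin_le_nhds)).congr fun t => (hAeq t).symm)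
    have er : Function.rightLim A x = r + B x := rightLim_eq_of_tendsto
      (((tendsto_const_nhds.congr' (hr.mono fun _ ht => ht.symm)).add
        (hBc.continuousAt.tendsto.mono_left nhdsWithin_le_nhds)).congr fun t => (hAeq t).symm)
    rw [jump, jump, el, er, leftLim_eq_of_eventually hl, rightLim_eq_of_eventually hr]
    ring
  have hzero (x : ℝ) (hx : x ∉ G) : jump A x = 0 := by
    have := hT.eventually_eq hx
    rw [hjump, jump, leftLim_eq_of_eventually (this.filter_mono nhdsWithin_le_nhds),
      rightLim_eq_of_eventually (this.filter_mono nhdsWithin_le_nhds), sub_self]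
  have hderiv (t : ℝ) (ht : t ∉ G) : deriv A t = deriv B t := by
    have e : A =ᶠ[𝓝 t] fun s => T t + B s := by
      filter_upwards [hT.eventually_eq ht] with s hs
      rw [hAeq, hs]
    rw [e.deriv_eq, deriv_const_add]
  have hae : ∀ᵐ t, t ∈ Set.uIoc (0 : ℝ) 1 → |deriv A t| ≤ max K 0 := by
    have hn : ∀ᵐ t : ℝ, t ∉ ((insert 1 G : Finset ℝ) : Set ℝ) :=
      (Finset.finite_toSet _).measure_zero volume |> measure_eq_zero_iff_ae_notMem.1
    filter_upwards [hn] with t ht h1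
    rw [Set.uIoc_of_le zero_le_one] at h1
    simp only [Finset.coe_insert, Set.mem_insert_iff, Finset.mem_coe, not_or] at ht
    rw [hderiv t ht.2]
    exact (hK t ⟨h1.1, lt_of_le_of_ne h1.2 ht.1⟩ ht.2).trans (le_max_left _ _)
  have hint : IntervalIntegrable (deriv A) volume 0 1 := by
    refine (intervalIntegrable_const (c := max K 0)).mono_fun'
      (measurable_deriv A).aestronglyMeasurable ?_
    exact (ae_restrict_iff' measurableSet_uIoc).2 hae
  have hftc : ∫ t in (0 : ℝ)..1, deriv A t = B 1 - B 0 := by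
    refine integral_eq_of_hasDerivAt_off_countable_of_le B (deriv A) zero_le_one
      G.countable_toSet hBc.continuousOn (fun t ht => ?_) hint
    rw [hderiv t ht.2]
    exact hBd t ht.1 ht.2
  refine ⟨G, max K 0, le_max_right _ _, hzero, hae, ?_⟩
  obtain ⟨y, hy⟩ := G.bddAbove
  obtain ⟨x, hx⟩ := G.bddBelow
  -- Both evaluation points lie outside `[0, 1]` and beyond all breakpoints. There `A` vanishes, so
  -- the jumps of `T` add up to `B 0 - B 1`, which cancels the integral of the derivative.
  have hsum := sum_jump_eq G hT (x := min 0 x - 1) (y := max 1 y + 1)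
    (by linarith [min_le_left 0 x, le_max_left 1 y])
    (fun z hz => by linarith [min_le_right 0 x, hx hz])
    (fun z hz => by linarith [le_max_right 1 y, hy hz])
  have a1 := hAeq (max 1 y + 1)
  have a0 := hAeq (min 0 x - 1)
  rw [hA.zero_right _ (by linarith [le_max_left 1 y]), hB1 _ (by linarith [le_max_left 1 y])] at a1
  rw [hδ _ (by linarith [min_le_left 0 x]), hB0 _ (by linarith [min_le_left 0 x])] at a0
  rw [Finset.sum_congr rfl fun z _ => hjump z, hsum, hftc]
  linarith

/-- The functional kills the constant `κ` and sends `θ * log` to `θ`, so only the remainder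
contributes, at most its supremum times the variation of `A`. Since `A` vanishes up to `δ`, only
`[δ, 1]` matters, where `log` is bounded. -/
lemma IsWeight.exists_abs_stieltjes_sub_le {A : ℝ → ℝ} (hA : IsWeight A) :
    ∃ δ C : ℝ, 0 < δ ∧ δ < 1 ∧ 0 ≤ C ∧ ∀ (f : ℝ → ℝ) (κ θ η : ℝ), Measurable f →
      (∀ t ∈ Set.Icc δ 1, |f t - κ - θ * Real.log t| ≤ η) →
      |stieltjesIntegral f A - θ| ≤ C * η := by
  classical
  obtain ⟨G, K, hK0, hzero, hae, hmass⟩ := hA.exists_jumps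
  obtain ⟨δ, hδ0, hδ1, hδ⟩ := hA.zero_left
  have hjump (x : ℝ) (hx : x ∉ Set.Icc δ 1) : jump A x = 0 := by
    have : ∀ᶠ t in 𝓝 x, A t = 0 := by
      rw [Set.mem_Icc, not_and_or, not_le, not_le] at hx
      rcases hx with h | h
      · filter_upwards [Iio_mem_nhds h] with t ht using hδ t (le_of_lt ht)
      · filter_upwards [Ioi_mem_nhds h] with t ht using hA.zero_right t (le_of_lt ht)
    rw [jump, leftLim_eq_of_eventually (this.filter_mono nhdsWithin_le_nhds),
      rightLim_eq_of_eventually (this.filter_mono nhdsWithin_le_nhds), sub_self]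
  have hder (t : ℝ) (ht : t < δ) : deriv A t = 0 := by
    have : A =ᶠ[𝓝 t] fun _ => 0 := by
      filter_upwards [Iio_mem_nhds ht] with s hs using hδ s (le_of_lt hs)
    rw [this.deriv_eq, deriv_const]
  have hS (f : ℝ → ℝ) : stieltjesIntegral f A =
      (∑ x ∈ G, f x * jump A x) + ∫ t in (0 : ℝ)..1, f t * deriv A t := by
    rw [stieltjesIntegral]
    congr 1
    refine finsum_eq_finsetSum_of_support_subset _ fun x hx => ?_
    by_contra h
    have := hzero x h
    rw [jump] at this
    simp [this] at hx
  have hprod {f : ℝ → ℝ} {M : ℝ} (hM : ∀ t ∈ Set.Icc δ 1, |f t| ≤ M) :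
      ∀ᵐ t, t ∈ Set.uIoc (0 : ℝ) 1 → ‖f t * deriv A t‖ ≤ M * K := by
    have hM0 : 0 ≤ M := (abs_nonneg _).trans (hM 1 ⟨hδ1.le, le_rfl⟩)
    filter_upwards [hae] with t ht h1
    have h2 := ht h1
    rw [Set.uIoc_of_le zero_le_one] at h1
    rw [norm_mul, Real.norm_eq_abs, Real.norm_eq_abs]
    rcases lt_or_ge t δ with h | h
    · rw [hder t h, abs_zero, mul_zero]; positivity
    · exact mul_le_mul (hM t ⟨h, h1.2⟩) h2 (abs_nonneg _) hM0
  have hint {f : ℝ → ℝ} {M : ℝ} (hf : Measurable f) (hM : ∀ t ∈ Set.Icc δ 1, |f t| ≤ M) :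
      IntervalIntegrable (fun t => f t * deriv A t) volume 0 1 := by
    refine (intervalIntegrable_const (c := M * K)).mono_fun'
      (hf.mul (measurable_deriv A)).aestronglyMeasurable ?_
    exact (ae_restrict_iff' measurableSet_uIoc).2 (hprod hM)
  have hlog (t : ℝ) (ht : t ∈ Set.Icc δ 1) : |Real.log t| ≤ -Real.log δ := by
    rw [abs_of_nonpos (Real.log_nonpos (hδ0.le.trans ht.1) ht.2)]
    exact neg_le_neg (Real.log_le_log hδ0 ht.1)
  refine ⟨δ, ∑ x ∈ G, |jump A x| + K, hδ0, hδ1, by positivity, fun f κ θ η hf hη => ?_⟩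
  set g : ℝ → ℝ := fun t => f t - κ - θ * Real.log t with hg
  have hgm : Measurable g := (hf.sub_const κ).sub (Real.measurable_log.const_mul θ)
  have hdec : stieltjesIntegral f A - θ = stieltjesIntegral g A := by
    have e1 : (∑ x ∈ G, f x * jump A x) = (∑ x ∈ G, g x * jump A x) +
        κ * (∑ x ∈ G, jump A x) + θ * ∑ x ∈ G, Real.log x * jump A x := by
      rw [Finset.mul_sum, Finset.mul_sum, ← Finset.sum_add_distrib, ← Finset.sum_add_distrib]
      exact Finset.sum_congr rfl fun x _ => by simp only [hg]; ring
    have e2 : ∫ t in (0 : ℝ)..1, f t * deriv A t = (∫ t in (0 : ℝ)..1, g t * deriv A t) +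
        κ * (∫ t in (0 : ℝ)..1, deriv A t) + θ * ∫ t in (0 : ℝ)..1, Real.log t * deriv A t := by
      have i1 := hint hgm hη
      have i2 : IntervalIntegrable (fun t => κ * deriv A t) volume 0 1 :=
        hint (f := fun _ => κ) measurable_const (fun _ _ => le_rfl)
      have i3 := (hint Real.measurable_log hlog).const_mul θ
      rw [← intervalIntegral.integral_const_mul, ← intervalIntegral.integral_const_mul,
        ← intervalIntegral.integral_add i1 i2, ← intervalIntegral.integral_add (i1.add i2) i3]
      exact intervalIntegral.integral_congr fun t _ => by simp only [hg]; ring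
    have e3 := hA.integral_log
    rw [hS] at e3
    rw [hS, hS, e1, e2]
    linear_combination κ * hmass + θ * e3
  rw [hdec, hS]
  refine (abs_add_le _ _).trans ?_
  rw [add_mul]
  refine add_le_add ?_ ?_
  · refine (Finset.abs_sum_le_sum_abs _ _).trans ?_
    rw [Finset.sum_mul]
    refine Finset.sum_le_sum fun x _ => ?_
    rw [abs_mul, mul_comm]
    by_cases hx : x ∈ Set.Icc δ 1
    · exact mul_le_mul_of_nonneg_left (hη x hx) (abs_nonneg _)
    · simp [hjump x hx]
  · have := intervalIntegral.norm_integral_le_of_norm_le_const_ae (hprod hη)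
    rw [Real.norm_eq_abs, sub_zero, abs_one, mul_one, mul_comm] at this
    exact this

/-! ### From concentration along powers to logarithmic growth. -/

lemma numDistinct_mono (w : ℕ → ℕ) : Monotone (numDistinct w) := fun _ _ h =>
  Finset.card_le_card (Finset.image_subset_image (Finset.range_mono h))

lemma one_le_numDistinct (w : ℕ → ℕ) {k : ℕ} (hk : 1 ≤ k) : 1 ≤ numDistinct w k :=
  (numDistinct_mono w hk).trans' (by simp [numDistinct])

lemma abs_log_one_add_le {d : ℝ} (hd : |d| ≤ 1 / 2) : |Real.log (1 + d)| ≤ 2 * |d| := by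
  have h := abs_le.1 hd
  have hpos : 0 < 1 + d := by linarith
  have l1 := Real.log_le_sub_one_of_pos hpos
  have l2 := Real.one_sub_inv_le_log_of_pos hpos
  rw [abs_le]
  constructor
  · have : (1 + d)⁻¹ ≤ 1 + 2 * |d| := by
      rw [inv_le_iff_one_le_mul₀ hpos]
      rcases abs_cases d with ⟨e, _⟩ | ⟨e, _⟩ <;> rw [e] <;> nlinarith
    linarith
  · linarith [le_abs_self d, abs_nonneg d]

/-- Concentration of the number of distinct words along the powers `m ^ L`, turned into a bound
for its logarithm at all times. -/
lemma exists_log_numDistinct_bound {θ a b : ℝ} (h0 : 0 < θ) (h1 : θ < 1) (ha : -1 < a) {L : ℕ}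
    (hL : 4 ≤ L * θ) :
    ∃ (C : ℝ) (M₀ : ℕ), 0 ≤ C ∧ 1 ≤ M₀ ∧ ∀ M ≥ M₀, ∀ q ∈ Set.Icc a b, ∀ w : ℕ → ℕ,
      (∀ m ≥ M, |(numDistinct w (m ^ L) : ℝ) - meanDistinct θ q (m ^ L)| ≤
        ((m ^ L : ℕ) : ℝ) ^ θ / m) →
      ∀ k ≥ M ^ L, |Real.log (numDistinct w k) - (Real.log (growthCoeff θ q) +
        θ * Real.log k)| ≤ C * (k : ℝ) ^ (-(1 / (L : ℝ))) := by
  rcases lt_or_ge b a with hba | hab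
  · exact ⟨0, 1, le_rfl, le_rfl, fun M _ q hq => absurd (hq.1.trans hq.2) (not_le.2 hba)⟩
  have hL0 : L ≠ 0 := by rintro rfl; norm_num at hL
  have hLpos : (0 : ℝ) < L := by positivity
  set D₀ := growthCoeff θ a with hD₀
  have hD₀p : 0 < D₀ := growthCoeff_pos h0 h1 ha
  set C₁ := 2 * ((4 + b) / D₀) with hC₁
  have hC₁p : 0 < C₁ := by
    have : 0 < 4 + b := by linarith
    positivity
  -- `M₀ ≥ C₁` keeps the relative error `(C₁ / 2) / m` at most `1 / 2`, as the logarithm bound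
  -- requires.
  refine ⟨2 * (C₁ + L), ⌈C₁⌉₊ + 1, by positivity, by omega, fun M hM q hq w hw k hk => ?_⟩
  have hM1 : 1 ≤ M := by omega
  have hq1 : -1 < q := by linarith [hq.1]
  set D := growthCoeff θ q with hD
  have hDD : D₀ ≤ D := growthCoeff_mono h0 h1 ha hq.1
  have hDp : 0 < D := hD₀p.trans_le hDD
  have sub (m : ℕ) (hm : M ≤ m) : |Real.log (numDistinct w (m ^ L)) -
      (Real.log D + θ * (L * Real.log m))| ≤ C₁ / m := by
    have hm1 : 1 ≤ m := hM1.trans hm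
    have hm1' : (1 : ℝ) ≤ m := by exact_mod_cast hm1
    have hmC : C₁ ≤ m := by
      have h : ⌈C₁⌉₊ ≤ m := by omega
      exact (Nat.le_ceil _).trans (by exact_mod_cast h)
    have hR : (1 : ℝ) ≤ numDistinct w (m ^ L) := by
      exact_mod_cast one_le_numDistinct w (Nat.one_le_pow _ _ hm1)
    set R : ℝ := ((numDistinct w (m ^ L) : ℕ) : ℝ)
    set Q : ℝ := ((m ^ L : ℕ) : ℝ) ^ θ with hQ
    have hQe : Q = (m : ℝ) ^ (L * θ) := by
      rw [hQ, Nat.cast_pow, ← Real.rpow_natCast, ← Real.rpow_mul (by positivity)]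
    -- This absorbs the bounded error `3 + b` of the mean into a multiple of `Q / m`.
    have hmQ : (m : ℝ) ≤ Q := by
      rw [hQe]
      calc (m : ℝ) = (m : ℝ) ^ (1 : ℝ) := (Real.rpow_one _).symm
        _ ≤ _ := Real.rpow_le_rpow_of_exponent_le hm1' (by linarith)
    have hQp : 0 < Q := by linarith
    have e1 : |R - D * Q| ≤ Q / m + (3 + b) := by
      have := abs_meanDistinct_sub_le h0 h1 hq1 (m ^ L)
      calc |R - D * Q| ≤ |R - meanDistinct θ q (m ^ L)| + |meanDistinct θ q (m ^ L) - D * Q| :=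
            abs_sub_le _ _ _
        _ ≤ _ := add_le_add (hw m hm) (this.trans (by linarith [hq.2]))
    have e2 : |R / (D * Q) - 1| ≤ (C₁ / 2) / m := by
      have hDQ : 0 < D * Q := by positivity
      have : R / (D * Q) - 1 = (R - D * Q) / (D * Q) := by field_simp
      rw [this, abs_div, abs_of_pos hDQ, div_le_iff₀ hDQ]
      have h3 : 3 + b ≤ (3 + b) * (Q / m) := by
        have : 1 ≤ Q / m := by rwa [one_le_div (by linarith)]
        nlinarith
      have h4 : (C₁ / 2) / m * (D₀ * Q) = (4 + b) * (Q / m) := by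
        rw [hC₁]; field_simp
      have h5 : (C₁ / 2) / m * (D₀ * Q) ≤ (C₁ / 2) / m * (D * Q) := by gcongr
      linarith
    have e3 : (C₁ / 2) / m ≤ 1 / 2 := by
      rw [div_le_iff₀ (by linarith)]; linarith
    have e4 := abs_log_one_add_le (e2.trans e3)
    rw [add_sub_cancel, Real.log_div (by linarith) (by positivity),
      Real.log_mul hDp.ne' hQp.ne', hQe, Real.log_rpow (by linarith)] at e4
    rw [hQe] at e2
    calc _ = |Real.log R - (Real.log D + L * θ * Real.log m)| := by ring_nf
      _ ≤ 2 * (C₁ / 2 / m) := e4.trans (by linarith)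
      _ = C₁ / m := by ring
  have hk1 : 1 ≤ k := (Nat.one_le_pow _ _ hM1).trans hk
  -- Consecutive `L`-th powers around `k` have logarithms within `L / m`, so monotonicity of `R`
  -- costs no more than that.
  obtain ⟨m, hmM, hmk, hkm⟩ : ∃ m ≥ M, m ^ L ≤ k ∧ k < (m + 1) ^ L := by
    have hP : ∃ m, k < (m + 1) ^ L :=
      ⟨k, (Nat.lt_succ_self k).trans_le (Nat.le_self_pow hL0 _)⟩
    classical
    have hMm : M ≤ Nat.find hP := by
      by_contra! h
      have h1 := Nat.find_spec hP
      have h2 : (Nat.find hP + 1) ^ L ≤ M ^ L := Nat.pow_le_pow_left h L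
      omega
    refine ⟨Nat.find hP, hMm, ?_, Nat.find_spec hP⟩
    have h3 := Nat.find_min hP (m := Nat.find hP - 1) (by omega)
    rwa [Nat.sub_add_cancel (hM1.trans hMm), not_lt] at h3
  have hm1 : (1 : ℝ) ≤ m := by exact_mod_cast hM1.trans hmM
  have hkp : (0 : ℝ) < k := by exact_mod_cast hk1
  have s1 := abs_le.1 (sub m hmM)
  have s2 := abs_le.1 (sub (m + 1) (by omega))
  have hRm : (1 : ℝ) ≤ numDistinct w (m ^ L) := by
    exact_mod_cast one_le_numDistinct w (Nat.one_le_pow _ _ (by omega))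
  have r1 : Real.log (numDistinct w (m ^ L)) ≤ Real.log (numDistinct w k) :=
    Real.log_le_log (by linarith) (by exact_mod_cast numDistinct_mono w hmk)
  have r2 : Real.log (numDistinct w k) ≤ Real.log (numDistinct w ((m + 1) ^ L)) :=
    Real.log_le_log (by exact_mod_cast one_le_numDistinct w hk1)
      (by exact_mod_cast numDistinct_mono w hkm.le)
  have k1 : L * Real.log m ≤ Real.log k := by
    rw [← Real.log_pow]
    exact Real.log_le_log (by positivity) (by exact_mod_cast hmk)
  have k2 : Real.log k ≤ L * Real.log (m + 1 : ℕ) := by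
    rw [← Real.log_pow]
    exact Real.log_le_log hkp (by exact_mod_cast hkm.le)
  have k3 : Real.log (m + 1 : ℕ) - Real.log m ≤ 1 / m := by
    rw [← Real.log_div (by positivity) (by positivity)]
    refine (Real.log_le_sub_one_of_pos (by positivity)).trans (le_of_eq ?_)
    push_cast
    field_simp
    ring
  have k4 : C₁ / (m + 1 : ℕ) ≤ C₁ / m := by
    gcongr; simp
  have k5 : θ * (L * (Real.log (m + 1 : ℕ) - Real.log m)) ≤ L / m := by
    calc θ * (L * (Real.log (m + 1 : ℕ) - Real.log m)) ≤ 1 * (L * (1 / m)) := by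
          refine mul_le_mul h1.le (by gcongr) ?_ zero_le_one
          have : Real.log m ≤ Real.log (m + 1 : ℕ) :=
            Real.log_le_log (by linarith) (by push_cast; linarith)
          have := sub_nonneg.2 this
          positivity
      _ = L / m := by ring
  have k6 := mul_le_mul_of_nonneg_left k1 h0.le
  have k7 := mul_le_mul_of_nonneg_left k2 h0.le
  have main : |Real.log (numDistinct w k) - (Real.log D + θ * Real.log k)| ≤ (C₁ + L) / m := by
    rw [abs_le, add_div]
    constructor <;> linarith
  refine main.trans ?_
  -- Since `m + 1 ≤ 2 * m`, the bound in `1 / m` becomes one in `k ^ (-1 / L)` at the cost of a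
  -- factor 2.
  have last : (k : ℝ) ^ (1 / (L : ℝ)) ≤ 2 * m := by
    have : (k : ℝ) ≤ (((m + 1 : ℕ) : ℝ)) ^ L := by exact_mod_cast hkm.le
    calc (k : ℝ) ^ (1 / (L : ℝ)) ≤ (((m + 1 : ℕ) : ℝ) ^ L) ^ (1 / (L : ℝ)) :=
          Real.rpow_le_rpow hkp.le this (by positivity)
      _ = (m + 1 : ℕ) := by rw [one_div, Real.pow_rpow_inv_natCast (by positivity) hL0]
      _ ≤ 2 * m := by push_cast; linarith
  have hkr : 0 < (k : ℝ) ^ (1 / (L : ℝ)) := by positivity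
  rw [Real.rpow_neg hkp.le, ← div_eq_mul_inv, div_le_div_iff₀ (by linarith) hkr]
  calc (C₁ + L) * (k : ℝ) ^ (1 / (L : ℝ)) ≤ (C₁ + L) * (2 * m) := by gcongr
    _ = 2 * (C₁ + L) * m := by ring

/-! ### The exponent estimate and the enclosure of the shift. -/

/-- The deviation of the exponent estimate under a bound for the logarithm of the number of
distinct words. -/
lemma exists_abs_thetaHat_sub_le {A : ℝ → ℝ} (hA : IsWeight A) {θ C γ : ℝ} (h0 : 0 < θ)
    (h1 : θ < 1) (hC : 0 ≤ C) (hγ0 : 0 < γ) (hγ1 : γ ≤ 1) :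
    ∃ C' : ℝ, ∀ K : ℕ, ∃ N : ℕ, ∀ n ≥ N, ∀ (w : ℕ → ℕ) (κ : ℝ),
      (∀ k ≥ K, |Real.log (numDistinct w k) - (κ + θ * Real.log k)| ≤ C * (k : ℝ) ^ (-γ)) →
      |thetaHat A w n - θ| ≤ C' * (n : ℝ) ^ (-γ) := by
  obtain ⟨δ, V, hδ0, hδ1, hV, hbound⟩ := hA.exists_abs_stieltjes_sub_le
  -- For `t ≥ δ` the condition `n * δ ≥ K + 2` makes the floor of `n * t` at least `K` and at least
  -- `n * δ / 2`.
  refine ⟨V * ((C + 1) * (δ / 2) ^ (-γ)), fun K => ⟨⌈(K + 2) / δ⌉₊, fun n hn w κ hw => ?_⟩⟩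
  have hnδ : K + 2 ≤ n * δ := by
    rw [← div_le_iff₀ hδ0]
    exact Nat.ceil_le.1 hn
  have hK0 := K.cast_nonneg (α := ℝ)
  have hn0 : (0 : ℝ) < n := by
    by_contra! h
    nlinarith
  have hmeas : Measurable fun t : ℝ => Real.posLog (numDistinct w ⌊(n : ℝ) * t⌋₊) :=
    (measurable_from_nat (f := fun k => Real.posLog (numDistinct w k))).comp
      (Nat.measurable_floor.comp (measurable_const_mul _))
  -- The intercept `κ + θ * log n` does not depend on `t`, so the functional removes it, although
  -- `κ` is unknown.
  have := hbound _ (κ + θ * Real.log n) θ ((C + 1) * (n * δ / 2) ^ (-γ)) hmeas fun t ht => ?_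
  · refine this.trans (le_of_eq ?_)
    rw [show (n : ℝ) * δ / 2 = δ / 2 * n by ring, Real.mul_rpow (by positivity) hn0.le]
    ring
  · have ht0 : 0 < t := hδ0.trans_le ht.1
    have hnt : n * δ ≤ n * t := by gcongr; exact ht.1
    set k := ⌊(n : ℝ) * t⌋₊ with hk
    have f1 : (k : ℝ) ≤ n * t := Nat.floor_le (by positivity)
    have f2 : n * t < k + 1 := Nat.lt_floor_add_one _
    have hk1 : (1 : ℝ) ≤ k := by linarith
    have hkK : K ≤ k := by
      have : (K : ℝ) ≤ k := by linarith
      exact_mod_cast this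
    have hR : (1 : ℝ) ≤ numDistinct w k := by
      exact_mod_cast one_le_numDistinct w (by exact_mod_cast hk1)
    rw [Real.posLog_eq_log (by rwa [abs_of_pos (by linarith)])]
    have g1 := hw k hkK
    have g2 : Real.log n + Real.log t = Real.log (n * t) :=
      (Real.log_mul hn0.ne' ht0.ne').symm
    have g3 : Real.log k ≤ Real.log (n * t) := Real.log_le_log (by linarith) f1
    have g4 : Real.log (n * t) - Real.log k ≤ (k : ℝ) ^ (-γ) := by
      rw [← Real.log_div (by positivity) (by positivity)]
      refine (Real.log_le_sub_one_of_pos (by positivity)).trans ?_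
      have : n * t / k - 1 ≤ (k : ℝ)⁻¹ := by
        rw [sub_le_iff_le_add, div_le_iff₀ (by linarith), add_mul, inv_mul_cancel₀ (by linarith)]
        linarith
      refine this.trans ?_
      rw [← Real.rpow_neg_one]
      exact Real.rpow_le_rpow_of_exponent_le hk1 (by linarith)
    have g5 : (k : ℝ) ^ (-γ) ≤ (n * δ / 2) ^ (-γ) :=
      Real.rpow_le_rpow_of_nonpos (by positivity) (by linarith) (by linarith)
    calc |Real.log (numDistinct w k) - (κ + θ * Real.log n) - θ * Real.log t|
        = |(Real.log (numDistinct w k) - (κ + θ * Real.log k)) +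
            θ * (Real.log k - Real.log (n * t))| := by rw [← g2]; ring_nf
      _ ≤ C * (k : ℝ) ^ (-γ) + 1 * (k : ℝ) ^ (-γ) := by
          refine (abs_add_le _ _).trans (add_le_add g1 ?_)
          rw [abs_mul, abs_of_pos h0, abs_sub_comm, abs_of_nonneg (sub_nonneg.2 g3)]
          exact mul_le_mul h1.le g4 (sub_nonneg.2 g3) zero_le_one
      _ = (C + 1) * (k : ℝ) ^ (-γ) := by ring
      _ ≤ (C + 1) * (n * δ / 2) ^ (-γ) := by gcongr

/-- For parameters close enough to `θ`, the Zipf-Mandelbrot means with the shifts `x₀ < a` and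
`x₁ > b` enclose the number of distinct words. -/
lemma eventually_enclosure {θ a b x₀ x₁ C C' γ : ℝ} (h0 : 0 < θ) (h1 : θ < 1) (hx₀ : -1 < x₀)
    (hx₀a : x₀ < a) (hbx₁ : b < x₁) (hγ0 : 0 < γ) (V : ℝ) :
    ∀ᶠ n : ℕ in atTop, ∀ θ', |θ' - θ| ≤ C' * (n : ℝ) ^ (-γ) → ∀ q ∈ Set.Icc a b,
      ∀ R : ℝ, 0 < R →
      |Real.log R - (Real.log (growthCoeff θ q) + θ * Real.log n)| ≤ C * (n : ℝ) ^ (-γ) →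
      0 < θ' ∧ θ' < 1 ∧ growthCoeff θ' x₀ * (n : ℝ) ^ θ' + (3 + x₀) < R ∧
        R < growthCoeff θ' x₁ * (n : ℝ) ^ θ' - (3 + x₁) ∧ V ≤ R := by
  rcases lt_or_ge b a with hba | hab
  · exact Eventually.of_forall fun n θ' _ q hq => absurd (hq.1.trans hq.2) (not_le.2 hba)
  have ha : -1 < a := hx₀.trans hx₀a
  have hb : -1 < b := ha.trans_le hab
  have hx₁ : -1 < x₁ := hb.trans hbx₁
  have hDa := growthCoeff_pos h0 h1 ha
  -- Strict monotonicity in the shift leaves the room needed for the perturbation of the exponent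
  -- and for the bounded errors.
  obtain ⟨l₁, hl₁, hl₁'⟩ := exists_between (growthCoeff_strictMono h0 h1 hx₀ hx₀a)
  obtain ⟨l₂, hl₂, hl₂'⟩ := exists_between (growthCoeff_strictMono h0 h1 hb hbx₁)
  have hl₁0 : 0 < l₁ := (growthCoeff_pos h0 h1 hx₀).trans hl₁
  have hl₂0 : 0 < l₂ := (growthCoeff_pos h0 h1 hb).trans hl₂
  have hnear : ∀ᶠ θ' in 𝓝 θ, 0 < θ' ∧ θ' < 1 ∧ growthCoeff θ' x₀ < l₁ ∧
      l₂ < growthCoeff θ' x₁ := by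
    filter_upwards [Ioo_mem_nhds h0 h1, (continuousAt_growthCoeff h0 h1 hx₀).eventually_lt_const hl₁,
      (continuousAt_growthCoeff h0 h1 hx₁).eventually_const_lt hl₂'] with t h2 h3 h4
      using ⟨h2.1, h2.2, h3, h4⟩
  obtain ⟨ε, hε, hball⟩ := Metric.eventually_nhds_iff.1 hnear
  have tρ (c : ℝ) : Tendsto (fun n : ℕ => c * (n : ℝ) ^ (-γ)) atTop (𝓝 0) := by
    simpa using ((tendsto_rpow_neg_atTop hγ0).comp tendsto_natCast_atTop_atTop).const_mul c
  -- The polynomial rate of the exponent beats `log n`, which is what makes `n ^ (θ' - θ)` tend to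
  -- 1.
  have tτ : Tendsto (fun n : ℕ => C' * (n : ℝ) ^ (-γ) * Real.log n) atTop (𝓝 0) := by
    have := ((isLittleO_log_rpow_atTop hγ0).tendsto_div_nhds_zero.comp
      tendsto_natCast_atTop_atTop).const_mul C'
    rw [mul_zero] at this
    refine this.congr fun n => ?_
    simp only [Function.comp, Real.rpow_neg n.cast_nonneg]
    ring
  have tθ : Tendsto (fun n : ℕ => (n : ℝ) ^ θ) atTop atTop :=
    (tendsto_rpow_atTop h0).comp tendsto_natCast_atTop_atTop
  have tE (c : ℝ) : Tendsto (fun n : ℕ => c / (n : ℝ) ^ θ) atTop (𝓝 0) :=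
    tendsto_const_nhds.div_atTop tθ
  have texp {u : ℕ → ℝ} (hu : Tendsto u atTop (𝓝 0)) (c : ℝ) :
      Tendsto (fun n => c * Real.exp (u n)) atTop (𝓝 c) := by
    simpa using (hu.rexp).const_mul c
  have ev1 : ∀ᶠ n : ℕ in atTop, l₁ * Real.exp (C' * (n : ℝ) ^ (-γ) * Real.log n) +
      (3 + x₀) / (n : ℝ) ^ θ < growthCoeff θ a * Real.exp (-(C * (n : ℝ) ^ (-γ))) := by
    refine ((texp tτ l₁).add (tE (3 + x₀))).eventually_lt
      (texp (by simpa using (tρ C).neg) _) ?_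
    simpa using hl₁'
  have ev2 : ∀ᶠ n : ℕ in atTop, growthCoeff θ b * Real.exp (C * (n : ℝ) ^ (-γ)) <
      l₂ * Real.exp (-(C' * (n : ℝ) ^ (-γ) * Real.log n)) - (3 + x₁) / (n : ℝ) ^ θ := by
    refine (texp (tρ C) _).eventually_lt
      ((texp (by simpa using tτ.neg) l₂).sub (tE (3 + x₁))) ?_
    simpa using hl₂
  have ev3 : ∀ᶠ n : ℕ in atTop,
      V / (n : ℝ) ^ θ < growthCoeff θ a * Real.exp (-(C * (n : ℝ) ^ (-γ))) :=
    (tE V).eventually_lt (texp (by simpa using (tρ C).neg) _) hDa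
  filter_upwards [ev1, ev2, ev3, (tρ C').eventually_lt_const hε, eventually_ge_atTop 1] with
    n e1 e2 e3 e4 hn1 θ' hθ' q hq R hR hlog
  obtain ⟨p0, p1, p2, p3⟩ := hball (y := θ') (by rw [Real.dist_eq]; exact hθ'.trans_lt e4)
  have hn : (1 : ℝ) ≤ n := by exact_mod_cast hn1
  have hnp : (0 : ℝ) < n := by linarith
  have hlogn := Real.log_nonneg hn
  have hq1 : -1 < q := ha.trans_le hq.1
  have hDq := growthCoeff_pos h0 h1 hq1
  have hnθ : 0 < (n : ℝ) ^ θ := by positivity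
  have hlog' := abs_le.1 hlog
  have hτ := abs_le.1 hθ'
  have hsplit : (n : ℝ) ^ θ' = (n : ℝ) ^ θ * Real.exp ((θ' - θ) * Real.log n) := by
    rw [mul_comm (θ' - θ), ← Real.rpow_def_of_pos hnp, ← Real.rpow_add hnp, add_sub_cancel]
  have hRlow : growthCoeff θ a * Real.exp (-(C * (n : ℝ) ^ (-γ))) * (n : ℝ) ^ θ ≤ R := by
    calc growthCoeff θ a * Real.exp (-(C * (n : ℝ) ^ (-γ))) * (n : ℝ) ^ θ
        ≤ growthCoeff θ q * Real.exp (-(C * (n : ℝ) ^ (-γ))) * (n : ℝ) ^ θ := by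
          gcongr; exact growthCoeff_mono h0 h1 ha hq.1
      _ = Real.exp (Real.log (growthCoeff θ q) + θ * Real.log n - C * (n : ℝ) ^ (-γ)) := by
          rw [sub_eq_add_neg, Real.exp_add, Real.exp_add, Real.exp_log hDq, mul_comm θ,
            ← Real.rpow_def_of_pos hnp]
          ring
      _ ≤ R := by
          rw [← Real.le_log_iff_exp_le hR]; linarith
  have hRup : R ≤ growthCoeff θ b * Real.exp (C * (n : ℝ) ^ (-γ)) * (n : ℝ) ^ θ := by
    calc R ≤ Real.exp (Real.log (growthCoeff θ q) + θ * Real.log n + C * (n : ℝ) ^ (-γ)) := by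
          rw [← Real.log_le_iff_le_exp hR]; linarith
      _ = growthCoeff θ q * Real.exp (C * (n : ℝ) ^ (-γ)) * (n : ℝ) ^ θ := by
          rw [Real.exp_add, Real.exp_add, Real.exp_log hDq, mul_comm θ,
            ← Real.rpow_def_of_pos hnp]
          ring
      _ ≤ _ := by gcongr; exact growthCoeff_mono h0 h1 hq1 hq.2
  refine ⟨p0, p1, ?_, ?_, ?_⟩
  · refine lt_of_lt_of_le ?_ hRlow
    have := mul_lt_mul_of_pos_right e1 hnθ
    rw [add_mul, div_mul_cancel₀ _ hnθ.ne'] at this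
    refine lt_of_le_of_lt ?_ this
    rw [hsplit]
    gcongr ?_ + _
    calc growthCoeff θ' x₀ * ((n : ℝ) ^ θ * Real.exp ((θ' - θ) * Real.log n))
        ≤ l₁ * ((n : ℝ) ^ θ * Real.exp (C' * (n : ℝ) ^ (-γ) * Real.log n)) := by
          gcongr; exact hτ.2
      _ = _ := by ring
  · refine lt_of_le_of_lt hRup ?_
    have := mul_lt_mul_of_pos_right e2 hnθ
    rw [sub_mul, div_mul_cancel₀ _ hnθ.ne'] at this
    refine lt_of_lt_of_le this ?_
    rw [hsplit]
    have := hl₂0.trans p3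
    gcongr ?_ - _
    calc l₂ * Real.exp (-(C' * (n : ℝ) ^ (-γ) * Real.log n)) * (n : ℝ) ^ θ
        = l₂ * ((n : ℝ) ^ θ * Real.exp (-(C' * (n : ℝ) ^ (-γ)) * Real.log n)) := by ring_nf
      _ ≤ growthCoeff θ' x₁ * ((n : ℝ) ^ θ * Real.exp ((θ' - θ) * Real.log n)) := by
          gcongr; exact hτ.1
  · have := mul_lt_mul_of_pos_right e3 hnθ
    rw [div_mul_cancel₀ _ hnθ.ne'] at this
    exact (this.trans_le hRlow).le

/-! ### Comparison of the bridges. -/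

/-- Each value is a convex combination of two neighbouring nodes. The node `n + 1` is included
because at `t = 1` the formula mentions it, with weight zero. -/
lemma abs_interpolate_sub_le {u v : ℕ → ℝ} {n : ℕ} {t E : ℝ} (ht0 : 0 ≤ t) (ht1 : t ≤ 1)
    (h : ∀ k ≤ n + 1, |u k - v k| ≤ E) : |interpolate u n t - interpolate v n t| ≤ E := by
  unfold interpolate
  set k := ⌊(n : ℝ) * t⌋₊
  have hnt : 0 ≤ (n : ℝ) * t := by positivity
  have hkn : k ≤ n := Nat.floor_le_of_le (by nlinarith [n.cast_nonneg (α := ℝ)])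
  have f1 : (k : ℝ) ≤ n * t := Nat.floor_le hnt
  have f2 : n * t < k + 1 := Nat.lt_floor_add_one _
  set s := (n : ℝ) * t - k
  have h1 := h k (by omega)
  have h2 := h (k + 1) (by omega)
  have hs0 : 0 ≤ s := sub_nonneg.2 f1
  have hs1 : s ≤ 1 := by simp only [s]; linarith
  calc _ = |(1 - s) * (u k - v k) + s * (u (k + 1) - v (k + 1))| := by ring_nf
    _ ≤ (1 - s) * |u k - v k| + s * |u (k + 1) - v (k + 1)| := by
        refine (abs_add_le _ _).trans (le_of_eq ?_)
        rw [abs_mul, abs_mul, abs_of_nonneg hs0, abs_of_nonneg (sub_nonneg.2 hs1)]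
    _ ≤ (1 - s) * E + s * E := by
        have := sub_nonneg.2 hs1
        gcongr
    _ = E := by ring

/-- The two bridges differ by `O(1 / √R_n)` when the shift estimate is bounded. -/
lemma IsShiftEstimate.abs_bridge_sub_le {A : ℝ → ℝ} {w : ℕ → ℕ} {n : ℕ} {x x₁ : ℝ} (hn : 1 ≤ n)
    (h : IsShiftEstimate A w n x) (hx : x ≤ x₁) {t : ℝ} (ht : t ∈ Set.Icc (0 : ℝ) 1) :
    |powerBridge A w n t - textBridge A w n x t| ≤
      3 * (3 + x₁) / √(numDistinct w n : ℝ) := by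
  obtain ⟨h0, h1, hx1, hr⟩ := h
  set θ := thetaHat A w n
  set D := growthCoeff θ x
  refine abs_interpolate_sub_le ht.1 ht.2 fun k hk => ?_
  have hnp : (0 : ℝ) < n := by exact_mod_cast hn
  rw [← sub_div, abs_div, abs_of_nonneg (Real.sqrt_nonneg _)]
  gcongr
  have e1 := abs_meanDistinct_sub_le h0 h1 hx1 k
  have e2 := abs_meanDistinct_sub_le h0 h1 hx1 n
  rw [hr] at e2
  -- The bound is 2 rather than 1 because of the extra node `k = n + 1`.
  have hkn : (k : ℝ) / n ≤ 2 := by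
    rw [div_le_iff₀ hnp]
    exact_mod_cast (by omega : k ≤ 2 * n)
  have hpow : ((k : ℝ) / n) ^ θ ≤ 2 := by
    rcases le_total ((k : ℝ) / n) 1 with hle | hle
    · exact (Real.rpow_le_one (by positivity) hle h0.le).trans one_le_two
    · exact (Real.rpow_le_self_of_one_le hle h1.le).trans hkn
  have hpow0 : 0 ≤ ((k : ℝ) / n) ^ θ := by positivity
  have hmul : ((k : ℝ) / n) ^ θ * (n : ℝ) ^ θ = (k : ℝ) ^ θ := by
    rw [← Real.mul_rpow (by positivity) hnp.le, div_mul_cancel₀ _ hnp.ne']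
  -- The leading terms `D * k ^ θ` of both centerings cancel, leaving only bounded errors.
  calc _ = |(meanDistinct θ x k - D * (k : ℝ) ^ θ) -
        ((k : ℝ) / n) ^ θ * ((numDistinct w n : ℝ) - D * (n : ℝ) ^ θ)| := by
          rw [← hmul]; congr 1; ring
    _ ≤ (3 + x) + 2 * (3 + x) := by
        refine (abs_sub _ _).trans (add_le_add e1 ?_)
        rw [abs_mul, abs_of_nonneg hpow0]
        exact mul_le_mul hpow e2 (abs_nonneg _) zero_le_two
    _ ≤ 3 * (3 + x₁) := by linarith

/-- The event at time `n`: a shift estimate exists, and for every one the bridges are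
`ε`-close. -/
def IsGoodTime (A : ℝ → ℝ) (w : ℕ → ℕ) (ε : ℝ) (n : ℕ) : Prop :=
  (∃ x, IsShiftEstimate A w n x) ∧ ∀ x, IsShiftEstimate A w n x →
    ∀ t ∈ Set.Icc (0 : ℝ) 1, |powerBridge A w n t - textBridge A w n x t| ≤ ε

/-- The deterministic core: `M₀` and `N` are chosen before `q` and the text `w`, which is the source
of the uniformity. -/
lemma exists_forall_isGoodTime {A : ℝ → ℝ} (hA : IsWeight A) {θ a b : ℝ} (h0 : 0 < θ)
    (h1 : θ < 1) (ha : -1 < a) {L : ℕ} (hL : 4 ≤ L * θ) {ε : ℝ} (hε : 0 < ε) :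
    ∃ M₀ : ℕ, 1 ≤ M₀ ∧ ∀ M ≥ M₀, ∃ N : ℕ, ∀ q ∈ Set.Icc a b, ∀ w : ℕ → ℕ,
      (∀ m ≥ M, |(numDistinct w (m ^ L) : ℝ) - meanDistinct θ q (m ^ L)| ≤
        ((m ^ L : ℕ) : ℝ) ^ θ / m) → ∀ n ≥ N, IsGoodTime A w ε n := by
  rcases lt_or_ge b a with hba | hab
  · exact ⟨1, le_rfl, fun M _ => ⟨0, fun q hq => absurd (hq.1.trans hq.2) (not_le.2 hba)⟩⟩
  have hL1 : 1 ≤ L := by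
    rcases L.eq_zero_or_pos with rfl | h
    · norm_num at hL
    · exact h
  have hLp : (1 : ℝ) ≤ L := by exact_mod_cast hL1
  obtain ⟨C, M₀, hC, hM₀, hlog⟩ := exists_log_numDistinct_bound (b := b) h0 h1 ha hL
  obtain ⟨C', hθ⟩ := exists_abs_thetaHat_sub_le hA (C := C) (γ := 1 / (L : ℝ)) h0 h1 hC
    (by positivity) (by rw [div_le_one (by positivity)]; exact hLp)
  set x₁ := b + 1
  set x₀ := (a - 1) / 2
  have hx₀ : -1 < x₀ := by simp only [x₀]; linarith
  have hx₁ : -1 < x₁ := by simp only [x₁]; linarith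
  have hE : 0 < 3 * (3 + x₁) / ε := by
    have : 0 < 3 + x₁ := by linarith
    positivity
  have henc := eventually_enclosure (a := a) (b := b) (x₀ := x₀) (x₁ := x₁) (C := C) (C' := C')
    (γ := 1 / (L : ℝ)) h0 h1 hx₀ (by simp only [x₀]; linarith) (by simp only [x₁]; linarith)
    -- Once `R` exceeds this square, `3 * (3 + x₁) / √R ≤ ε`.
    (by positivity) ((3 * (3 + x₁) / ε) ^ 2)
  obtain ⟨N₁, hN₁⟩ := eventually_atTop.1 henc
  refine ⟨M₀, hM₀, fun M hM => ?_⟩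
  obtain ⟨N₂, hN₂⟩ := hθ (M ^ L)
  refine ⟨max (max N₁ N₂) (max 1 (M ^ L)), fun q hq w hw n hn => ?_⟩
  have hnN₁ : n ≥ N₁ := (le_max_left _ _).trans ((le_max_left _ _).trans hn)
  have hnN₂ : n ≥ N₂ := (le_max_right _ _).trans ((le_max_left _ _).trans hn)
  have hn1 : 1 ≤ n := (le_max_left _ _).trans ((le_max_right _ _).trans hn)
  have hnM : n ≥ M ^ L := (le_max_right _ _).trans ((le_max_right _ _).trans hn)
  have hR : (0 : ℝ) < numDistinct w n := by exact_mod_cast one_le_numDistinct w hn1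
  have hl := hlog M hM q hq w hw
  obtain ⟨p0, p1, low, up, hV⟩ := hN₁ n hnN₁ (thetaHat A w n) (hN₂ n hnN₂ w _ hl) q hq
    (numDistinct w n) hR (hl n hnM)
  have m0 := (abs_le.1 (abs_meanDistinct_sub_le p0 p1 hx₀ n)).2
  have m1 := (abs_le.1 (abs_meanDistinct_sub_le p0 p1 hx₁ n)).1
  refine ⟨?_, fun x hx t ht => ?_⟩
  · have hx₀₁ : x₀ ≤ x₁ := by simp only [x₀, x₁]; linarith
    obtain ⟨x, hx, hxe⟩ := intermediate_value_Icc hx₀₁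
      (continuousOn_meanDistinct p0 p1 hx₀ n (x₁ := x₁))
      (⟨by linarith, by linarith⟩ : (numDistinct w n : ℝ) ∈ Set.Icc _ _)
    exact ⟨x, p0, p1, hx₀.trans_le hx.1, hxe⟩
  -- A shift estimate above `x₁` would have mean at least that of `x₁`, which strictly exceeds
  -- `R_n`.
  · have hxx : x ≤ x₁ := by
      by_contra! hlt
      have := meanDistinct_mono p0 p1 hx₁ hlt.le n
      rw [hx.2.2.2] at this
      linarith
    refine (hx.abs_bridge_sub_le hn1 hxx ht).trans ?_
    rw [div_le_iff₀ (Real.sqrt_pos.2 hR), ← div_le_iff₀' hε]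
    exact Real.le_sqrt_of_sq_le hV

/-! ### Uniform probability bounds and almost sure statements. -/

/-- The probability of a deviation at some power `m ^ L` with `m ≥ M`, uniformly in the shift. -/
lemma exists_measure_deviation_le {θ a b : ℝ} (h0 : 0 < θ) (h1 : θ < 1) (ha : -1 < a) {L : ℕ}
    (hL : 4 ≤ L * θ) :
    ∃ C : ℝ, ∀ q ∈ Set.Icc a b, ∀ {Ω : Type*} [MeasurableSpace Ω] (P : Measure Ω)
      (X : ℕ → Ω → ℕ), IsZMText P X θ q → ∀ M ≥ 1,
      P {ω | ∃ m ≥ M, ((m ^ L : ℕ) : ℝ) ^ θ / m <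
        |(numDistinct (fun j => X j ω) (m ^ L) : ℝ) - meanDistinct θ q (m ^ L)|} ≤
      ∑' i : ℕ, ENNReal.ofReal (C / ((i + M : ℕ) : ℝ) ^ 2) := by
  refine ⟨growthCoeff θ b + (3 + b), fun q hq Ω _ P X hX M hM => ?_⟩
  have hq1 : -1 < q := by linarith [hq.1]
  have hb : -1 < b := by linarith [hq.2]
  have hDb := growthCoeff_pos h0 h1 hb
  refine (measure_mono (t := ⋃ i : ℕ, {ω | (((i + M) ^ L : ℕ) : ℝ) ^ θ / (i + M : ℕ) ≤
    |(numDistinct (fun j => X j ω) ((i + M) ^ L) : ℝ) - meanDistinct θ q ((i + M) ^ L)|})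
    ?_).trans ((measure_iUnion_le _).trans (ENNReal.tsum_le_tsum fun i => ?_))
  · rintro ω ⟨m, hm, hlt⟩
    refine Set.mem_iUnion.2 ⟨m - M, ?_⟩
    simp only [Set.mem_ofPred_eq, Nat.sub_add_cancel hm]
    exact hlt.le
  · set m := i + M with hm
    have hm1 : (1 : ℝ) ≤ m := by
      have : 1 ≤ m := by omega
      exact_mod_cast this
    set Q : ℝ := ((m ^ L : ℕ) : ℝ) ^ θ with hQ
    -- With mean `O(Q)` and threshold `Q / m`, Chebyshev gives `O(m ^ 2 / Q)`; this needs `Q ≥ m ^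
    -- 4` to be `O(m ^ (-2))`.
    have hmQ : (m : ℝ) ^ 4 ≤ Q := by
      rw [hQ, Nat.cast_pow, ← Real.rpow_natCast, ← Real.rpow_natCast, ← Real.rpow_mul (by positivity)]
      exact Real.rpow_le_rpow_of_exponent_le hm1 (by exact_mod_cast hL)
    have hQ1 : 1 ≤ Q := (one_le_pow₀ hm1).trans hmQ
    have hQp : 0 < Q := by linarith
    have ht : 0 < Q / m := by positivity
    refine (hX.measure_deviation_le h0 h1 hq1 (m ^ L) ht).trans (ENNReal.ofReal_le_ofReal ?_)
    have hmean : meanDistinct θ q (m ^ L) ≤ (growthCoeff θ b + (3 + b)) * Q := by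
      have e1 := (abs_le.1 (abs_meanDistinct_sub_le h0 h1 hq1 (m ^ L))).2
      have e2 := mul_le_mul_of_nonneg_right (growthCoeff_mono h0 h1 hq1 hq.2) hQp.le
      have e3 : 3 + q ≤ (3 + b) * Q := by nlinarith [hq.2]
      linarith
    have hc : 0 < growthCoeff θ b + (3 + b) := by linarith
    calc meanDistinct θ q (m ^ L) / (Q / m) ^ 2
        ≤ (growthCoeff θ b + (3 + b)) * Q / (Q / m) ^ 2 := by gcongr
      _ = (growthCoeff θ b + (3 + b)) * (m : ℝ) ^ 2 / Q := by field_simp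
      _ ≤ (growthCoeff θ b + (3 + b)) * (m : ℝ) ^ 2 / (m : ℝ) ^ 4 := by gcongr
      _ = (growthCoeff θ b + (3 + b)) / (m : ℝ) ^ 2 := by field_simp

lemma tendsto_iSup_measure_not_isGoodTime {θ : ℝ} (h0 : 0 < θ) (h1 : θ < 1) {A : ℝ → ℝ}
    (hA : IsWeight A) {a b : ℝ} (ha : -1 < a) {Ω : ℝ → Type*} [∀ q, MeasurableSpace (Ω q)]
    (P : ∀ q, Measure (Ω q)) (X : ∀ q, ℕ → Ω q → ℕ)
    (hX : ∀ q ∈ Set.Icc a b, IsZMText (P q) (X q) θ q) {ε : ℝ} (hε : 0 < ε) :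
    Tendsto (fun N : ℕ => ⨆ q ∈ Set.Icc a b,
      P q {ω | ∃ n ≥ N, ¬ IsGoodTime A (fun j => X q j ω) ε n}) atTop (𝓝 0) := by
  obtain ⟨L, hL⟩ : ∃ L : ℕ, 4 ≤ L * θ :=
    ⟨⌈4 / θ⌉₊, by rw [← div_le_iff₀ h0]; exact Nat.le_ceil _⟩
  obtain ⟨M₀, hM₀, hgood⟩ := exists_forall_isGoodTime hA (b := b) h0 h1 ha hL hε
  obtain ⟨C, hC⟩ := exists_measure_deviation_le (b := b) h0 h1 ha hL
  have hsum : ∑' i : ℕ, ENNReal.ofReal (C / (i : ℝ) ^ 2) ≠ ⊤ := by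
    have : Summable fun i : ℕ => C / (i : ℝ) ^ 2 := by
      simpa [div_eq_mul_inv] using (Real.summable_nat_pow_inv.2 one_lt_two).mul_left C
    exact this.tsum_ofReal_ne_top
  have htail := ENNReal.tendsto_sum_nat_add _ hsum
  rw [ENNReal.tendsto_nhds_zero] at htail ⊢
  intro η hη
  -- `M` makes the tail of the series at most `η`; `N` is then fixed by `M`, with no reference to
  -- `q`.
  obtain ⟨M, hMη, hM⟩ := ((htail η hη).and (eventually_ge_atTop M₀)).exists
  obtain ⟨N, hN⟩ := hgood M hM
  filter_upwards [eventually_ge_atTop N] with N' hN'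
  refine iSup₂_le fun q hq => ((measure_mono ?_).trans
    (hC q hq (P q) (X q) (hX q hq) M (hM₀.trans hM))).trans hMη
  rintro ω ⟨n, hn, hbad⟩
  by_contra hcon
  simp only [Set.mem_ofPred_eq, not_exists, not_and, not_lt] at hcon
  exact hbad (hN q hq _ hcon n (hN'.trans hn))

/-- The exceptional set lies in each of these events. Only monotonicity of the outer measure is
used, so no measurability is needed. -/
lemma ae_eventually_of_tendsto_measure {α : Type*} [MeasurableSpace α] {μ : Measure α}
    {p : ℕ → α → Prop} (h : Tendsto (fun N => μ {ω | ∃ n ≥ N, ¬ p n ω}) atTop (𝓝 0)) :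
    ∀ᵐ ω ∂μ, ∀ᶠ n in atTop, p n ω := by
  rw [ae_iff]
  refine le_antisymm (ge_of_tendsto' h fun N => measure_mono fun ω hω => ?_) zero_le
  by_contra hcon
  simp only [Set.mem_ofPred_eq, not_exists, not_and, not_not] at hcon
  exact hω (eventually_atTop.2 ⟨N, hcon⟩)

end TextBridge

end

theorem theorem2p3 (θ : ℝ) (hθ0 : 0 < θ) (hθ1 : θ < 1)
    (A : ℝ → ℝ) (hA : TextBridge.IsWeight A)
    (a b : ℝ) (ha : -1 < a)
    {Ω : ℝ → Type*} [∀ q, MeasurableSpace (Ω q)]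
    (P : ∀ q, Measure (Ω q)) (X : ∀ q, ℕ → Ω q → ℕ)
    (hX : ∀ q ∈ Set.Icc a b, TextBridge.IsZMText (P q) (X q) θ q) :
    -- a.s. the shift estimate exists for all large `n`
    (∀ q ∈ Set.Icc a b, ∀ᵐ ω ∂(P q), ∀ᶠ n : ℕ in atTop,
      ∃ x, TextBridge.IsShiftEstimate A (fun j => X q j ω) n x) ∧
    -- a.s. the difference of the bridges tends to zero uniformly on `[0,1]`,
    -- for every choice of the shift estimates
    (∀ q ∈ Set.Icc a b, ∀ᵐ ω ∂(P q), ∀ x : ℕ → ℝ,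
      (∀ᶠ n : ℕ in atTop, TextBridge.IsShiftEstimate A (fun j => X q j ω) n (x n)) →
      TendstoUniformlyOn
        (fun n t => TextBridge.powerBridge A (fun j => X q j ω) n t -
          TextBridge.textBridge A (fun j => X q j ω) n (x n) t)
        (fun _ => 0) atTop (Set.Icc 0 1)) ∧
    -- almost sure existence and convergence are uniform in `q ∈ [a,b]`
    (∀ ε > 0, Tendsto
      (fun N : ℕ => ⨆ q ∈ Set.Icc a b, P q {ω | ∃ n ≥ N,
        ¬ ((∃ x, TextBridge.IsShiftEstimate A (fun j => X q j ω) n x) ∧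
          ∀ x, TextBridge.IsShiftEstimate A (fun j => X q j ω) n x →
            ∀ t ∈ Set.Icc (0 : ℝ) 1,
              |TextBridge.powerBridge A (fun j => X q j ω) n t -
                TextBridge.textBridge A (fun j => X q j ω) n x t| ≤ ε)})
      atTop (𝓝 0)) := by
  -- This is the third claim with `IsGoodTime` folded; the first two are drawn from it.
  have hunif (ε : ℝ) (hε : 0 < ε) :=
    TextBridge.tendsto_iSup_measure_not_isGoodTime hθ0 hθ1 hA ha P X hX hε
  have hae (q : ℝ) (hq : q ∈ Set.Icc a b) (ε : ℝ) (hε : 0 < ε) :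
      ∀ᵐ ω ∂(P q), ∀ᶠ n in atTop, TextBridge.IsGoodTime A (fun j => X q j ω) ε n :=
    TextBridge.ae_eventually_of_tendsto_measure <| tendsto_of_tendsto_of_tendsto_of_le_of_le
      tendsto_const_nhds (hunif ε hε) (fun _ => zero_le)
      fun N => le_iSup₂ (f := fun q (_ : q ∈ Set.Icc a b) =>
        P q {ω | ∃ n ≥ N, ¬ TextBridge.IsGoodTime A (fun j => X q j ω) ε n}) q hq
  refine ⟨fun q hq => ?_, fun q hq => ?_, hunif⟩
  · filter_upwards [hae q hq 1 one_pos] with ω hω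
    exact hω.mono fun n hn => hn.1
  -- Countably many thresholds give one null set. It serves every choice of shift estimates at once,
  -- because `IsGoodTime` already quantifies over all of them.
  · have hall : ∀ᵐ ω ∂(P q), ∀ j : ℕ, ∀ᶠ n in atTop,
        TextBridge.IsGoodTime A (fun j => X q j ω) (1 / ((j : ℝ) + 1)) n :=
      ae_all_iff.2 fun j => hae q hq _ (by positivity)
    filter_upwards [hall] with ω hω x hx
    rw [Metric.tendstoUniformlyOn_iff]
    intro ε hε
    obtain ⟨j, hj⟩ := exists_nat_one_div_lt hε
    filter_upwards [hω j, hx] with n hn hxn t ht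
    rw [dist_comm, Real.dist_eq, sub_zero]
    exact (hn.2 (x n) hxn t ht).trans_lt hj
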